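/- A $k$-colouring of a finite simple graph $G$ is an assignment of one of $k$ colours to each vertex such that adjacent vertices receive different colours, and $G$ is $P_5$-free if no induced subgraph of $G$ is isomorphic to the path on five vertices. For each fixed integer $k\ge 0$ there is a deterministic Turing machine (with several stacks) which, given the adjacency matrix of any $P_5$-free graph $G$ (connected or not), halts after a number of steps bounded by a polynomial in the length of the input (the machine and the polynomial depend only on $k$), and which outputs a $k$-colouring of $G$ if $G$ is $k$-colourable and the answer "no" otherwise. In particular, $k$-colourability of $P_5$-free graphs can be decided in polynomial time. -/

import Mathlib

/-- A finite simple graph on the vertices `0, …, n - 1` that contains no induced path on five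
vertices. -/
structure P5FreeGraph where
  /-- the number of vertices -/
  n : ℕ
  /-- the graph itself, not necessarily connected -/
  graph : SimpleGraph (Fin n)
  /-- no induced subgraph is isomorphic to the path on five vertices -/
  p5free : ¬ SimpleGraph.IsIndContained (SimpleGraph.pathGraph 5) graph

/-- The input word of a graph: its adjacency matrix, row by row, one bit per entry, every row
being followed by a comma. The word has length `n * (n + 1)`. -/
noncomputable def P5FreeGraph.encode (G : P5FreeGraph) : List Computability.Γ' :=
  (List.finRange G.n).flatMap fun i =>
    ((List.finRange G.n).map fun j =>
      Computability.Γ'.bit (@decide (G.graph.Adj i j) (Classical.propDecidable _)))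
    ++ [Computability.Γ'.comma]

/-- The output word: the single symbol "no", or the symbol "yes" followed by the colours of the
vertices `0, …, n - 1`, one symbol for each vertex. -/
def encodeAnswer {k n : ℕ} {G : SimpleGraph (Fin n)} :
    Option (G.Coloring (Fin k)) → List (Bool ⊕ Fin k)
  | none => [Sum.inl false]
  | some c => Sum.inl true :: (List.finRange n).map fun v => Sum.inr (c v)

/-!
A graph without induced path on five vertices is `k`-colourable if and only if it satisfies a
certain first-order sentence that depends only on `k`. First-order sentences are evaluated in
polynomial time by nested loops over the vertices, and a colouring is found by self-reduction.

*The sentence.* More generally, let `L` be lists of `j + 1` colours in all for the vertices of a set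
`S`. In a `P₅`-free graph, the component in `S` of a vertex `r` consists of the ends of the walks of
length at most three from `r` (`ball`). If it has a list colouring, then it has a total dominating
set of bounded size (`exists_total_dominating`): a minimal dominating set gives each of its members
a private neighbour, and if there were more such pairs than pairs of colours, two of the pairs with
the same colours would give an induced `P₅` (`exists_small_dominating`). A sequence `d` of
dominating vertices partitions the component by first neighbour in `d`. By the same argument, for
each class and each colour `c`, a bounded number of vertices of the class with colour `c` is
adjacent to all later vertices that have a neighbour of colour `c` in the class at all. Guess these
vertices together with `d` and their colours, and remove the colours from the lists of their
neighbours. A colour that a vertex of a class still shares with an adjacent vertex of a later class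
is then not its own colour, and is removed from its list, too (`trimmed`, `separated`,
`exists_guess`). The list colouring survives, and the lists of a class no longer contain the colour
of the member of `d` that defines the class, so that `j` colours remain. Conversely, adjacent
vertices of different classes have disjoint lists after the removal, so that colourings of the
classes fit together. The recursion `Splits` on `j` expresses this, quantifying over `r`, `d`, `u`
and the colours of `u` only, where `u` are the guessed vertices, and it is equivalent to the
existence of a list colouring (`splits_iff`).

*The machine.* `Prog` is a small language of structured programs on stacks, and `Prog.machine`
translates a program into a multi-stack Turing machine that needs one more step, to halt. The
adjacency matrix is kept on one stack, with an additional column for the colours of the vertices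
that have one, and a bounded number of counters is kept in unary on other stacks. By induction on
the formula, first-order relations of the graph with a partial colouring are decided by programs in
polynomial time (`FO.exists_decides`). On `P₅`-free graphs, the extendability of a partial colouring
is such a relation (`exists_fo_extendable`), and the program `colorProg` colours the vertices one
after another with colours that keep the partial colouring extendable.
-/

/-! ### List colourings of `P₅`-free graphs -/

namespace P5Coloring

section Graph

variable {V C : Type}

/-- The graph has no induced path on five vertices. -/
def P5Free (G : SimpleGraph V) : Prop :=
  ¬ SimpleGraph.IsIndContained (SimpleGraph.pathGraph 5) G

theorem P5Free.elim {G : SimpleGraph V} (h : P5Free G) {a b c d e : V} (hab : G.Adj a b)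
    (hbc : G.Adj b c) (hcd : G.Adj c d) (hde : G.Adj d e) (hac : ¬ G.Adj a c) (had : ¬ G.Adj a d)
    (hae : ¬ G.Adj a e) (hbd : ¬ G.Adj b d) (hbe : ¬ G.Adj b e) (hce : ¬ G.Adj c e) : False := by
  have key : ∀ i j, G.Adj (![a, b, c, d, e] i) (![a, b, c, d, e] j) ↔
      (SimpleGraph.pathGraph 5).Adj i j := by
    intro i j
    rw [SimpleGraph.pathGraph_adj]
    fin_cases i <;> fin_cases j <;>
      simp [hab, hbc, hcd, hde, hac, had, hae, hbd, hbe, hce, hab.symm, hbc.symm, hcd.symm,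
        hde.symm, G.adj_comm c a, G.adj_comm d a, G.adj_comm e a, G.adj_comm d b, G.adj_comm e b,
        G.adj_comm e c]
  have inj : Function.Injective ![a, b, c, d, e] := by
    -- two equal vertices would have the same neighbours, but no two vertices of the path do
    have twins : ∀ i j : Fin 5, (∀ x : Fin 5, (i.val + 1 = x.val ∨ x.val + 1 = i.val) ↔
        (j.val + 1 = x.val ∨ x.val + 1 = j.val)) → i = j := by decide
    refine fun i j hij => twins i j fun x => ?_
    rw [← SimpleGraph.pathGraph_adj, ← SimpleGraph.pathGraph_adj, ← key, ← key, hij]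
  exact h ⟨⟨⟨_, inj⟩, fun {i j} => key i j⟩⟩

/-- A proper colouring of the subgraph induced on `S` that obeys the lists; `v ∈ L c` says that the
colour `c` is on the list of `v`. The values of `φ` outside `S` are irrelevant. -/
def IsListColoring (G : SimpleGraph V) (S : Set V) (L : C → Set V) (φ : V → C) : Prop :=
  (∀ v ∈ S, v ∈ L (φ v)) ∧ ∀ u ∈ S, ∀ v ∈ S, G.Adj u v → φ u ≠ φ v

/-- The vertices at the end of a walk in `S` of length one, two or three from `r`. If `G` is
`P₅`-free and `r` is not isolated in `S`, this is the component of `r`. -/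
def ball (G : SimpleGraph V) (S : Set V) (r : V) : Set V :=
  {v | v ∈ S ∧ (G.Adj r v ∨ (∃ a, a ∈ S ∧ G.Adj r a ∧ G.Adj a v) ∨
    ∃ a, a ∈ S ∧ ∃ b, b ∈ S ∧ G.Adj r a ∧ G.Adj a b ∧ G.Adj b v)}

/-- The vertices of `K` whose first neighbour in the sequence `d` is `d i`. -/
def firstNbr {m : ℕ} (G : SimpleGraph V) (K : Set V) (d : Fin m → V) (i : Fin m) : Set V :=
  {v | v ∈ K ∧ G.Adj (d i) v ∧ ∀ t, t < i → ¬ G.Adj (d t) v}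

/-- The vertices of `K` without a neighbour among the `d t` with `t ≤ i`. -/
def laterNbr {m : ℕ} (G : SimpleGraph V) (K : Set V) (d : Fin m → V) (i : Fin m) : Set V :=
  {v | v ∈ K ∧ ∀ t, t ≤ i → ¬ G.Adj (d t) v}

/-- The lists after the vertices `u t` have received the colours `γ t`. -/
def trimmed {M : ℕ} (G : SimpleGraph V) (L : C → Set V) (u : Fin M → V) (γ : Fin M → C) (c : C) :
    Set V :=
  {v | v ∈ L c ∧ ∀ t, γ t = c → ¬ G.Adj (u t) v}

/-- The vertices that have `c` on their list `L₁` and no neighbour in `B` which has `c` on its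
list. -/
def separated (G : SimpleGraph V) (L₁ : C → Set V) (B : Set V) (c : C) : Set V :=
  {v | v ∈ L₁ c ∧ ∀ b, b ∈ B → G.Adj v b → b ∉ L₁ c}

/-- A recursive first-order criterion for the existence of a list colouring of the subgraph
induced on `S`, where `j` bounds the number of colours on the lists. In a component that has an
edge, it guesses a sequence `d` of dominating vertices and finitely many coloured vertices `u`,
and asks the criterion with one colour less of each of the classes of the partition of the
component by first neighbour in `d`, with such lists that no two adjacent vertices of different
classes share a colour. -/
def Splits [Fintype C] (m M : ℕ) (G : SimpleGraph V) : ℕ → Set V → (C → Set V) → Prop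
  | 0, S, _ => ∀ v, v ∉ S
  | j + 1, S, L => ∀ r, r ∈ S →
    ((∃ s, s ∈ S ∧ G.Adj r s) ∨ ∃ c, r ∈ L c) ∧
    ((∀ s, s ∈ S → ¬ G.Adj r s) ∨ ∃ d : Fin m → V, ∃ u : Fin M → V, ∃ γ : Fin M → C,
      (∀ v, v ∈ ball G S r → ∃ i, G.Adj (d i) v) ∧
      ∀ i, Splits m M G j (firstNbr G (ball G S r) d i)
        (separated G (trimmed G L u γ) (laterNbr G (ball G S r) d i)))

theorem mem_ball_of_adj {G : SimpleGraph V} (hG : P5Free G) {S : Set V} {r v w : V}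
    (hv : v ∈ ball G S r) (hw : w ∈ S) (hvw : G.Adj v w) : w ∈ ball G S r := by
  obtain ⟨hvS, h | ⟨a, ha, h1, h2⟩ | ⟨a, ha, b, hb, h1, h2, h3⟩⟩ := hv
  · exact ⟨hw, .inr (.inl ⟨v, hvS, h, hvw⟩)⟩
  · exact ⟨hw, .inr (.inr ⟨a, ha, v, hvS, h1, h2, hvw⟩)⟩
  · by_contra hcon
    have n1 : ¬ G.Adj r w := fun h => hcon ⟨hw, .inl h⟩
    have n2 : ∀ x ∈ S, G.Adj r x → ¬ G.Adj x w := fun x hx h h' =>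
      hcon ⟨hw, .inr (.inl ⟨x, hx, h, h'⟩)⟩
    have n3 : ∀ x ∈ S, ∀ y ∈ S, G.Adj r x → G.Adj x y → ¬ G.Adj y w := fun x hx y hy h h' h'' =>
      hcon ⟨hw, .inr (.inr ⟨x, hx, y, hy, h, h', h''⟩)⟩
    exact hG.elim h1 h2 h3 hvw (fun h => n3 b hb v hvS h h3 hvw) (fun h => n2 v hvS h hvw) n1
      (fun h => n3 a ha v hvS h1 h hvw) (n2 a ha h1) (n3 a ha b hb h1 h2)

/-- Colourings of the components combine to a colouring of `S`. -/
theorem exists_isListColoring_of_ball [Nonempty C] {G : SimpleGraph V} (hG : P5Free G) {S : Set V}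
    {L : C → Set V} (h1 : ∀ r ∈ S, (∃ s, s ∈ S ∧ G.Adj r s) ∨ ∃ c, r ∈ L c)
    (h2 : ∀ r ∈ S, (∀ s, s ∈ S → ¬ G.Adj r s) ∨ ∃ φ : V → C, IsListColoring G (ball G S r) L φ) :
    ∃ φ : V → C, IsListColoring G S L φ := by
  classical
  have h1' : ∀ r, ∃ c, r ∈ S → (∀ s, s ∈ S → ¬ G.Adj r s) → r ∈ L c := by
    intro r
    by_cases hr : r ∈ S
    · obtain ⟨s, hs⟩ | ⟨c, hc⟩ := h1 r hr
      · exact ⟨Classical.arbitrary C, fun _ h => absurd hs.2 (h s hs.1)⟩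
      · exact ⟨c, fun _ _ => hc⟩
    · exact ⟨Classical.arbitrary C, fun h => absurd h hr⟩
  have h2' : ∀ r, ∃ φ : V → C, r ∈ S → (∃ s, s ∈ S ∧ G.Adj r s) →
      IsListColoring G (ball G S r) L φ := by
    intro r
    by_cases hr : r ∈ S
    · obtain h | ⟨φ, hφ⟩ := h2 r hr
      · exact ⟨fun _ => Classical.arbitrary C, fun _ ⟨s, hs⟩ => absurd hs.2 (h s hs.1)⟩
      · exact ⟨φ, fun _ _ => hφ⟩
    · exact ⟨fun _ => Classical.arbitrary C, fun h => absurd h hr⟩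
  choose c hc using h1'
  choose φ hφ using h2'
  -- the representative of a component depends only on the set of its possible representatives
  let P : V → V → Prop := fun v r => r ∈ S ∧ v ∈ ball G S r
  let ρ : V → V := fun v => @Classical.epsilon V ⟨v⟩ (P v)
  have hρ : ∀ v ∈ S, ∀ s ∈ S, G.Adj v s → P v (ρ v) := by
    intro v hv s hs hvs
    exact Classical.epsilon_spec (p := P v) ⟨v, hv, hv, .inr (.inl ⟨s, hs, hvs, hvs.symm⟩)⟩
  have hρ' : ∀ v r, P v r → ∃ s, s ∈ S ∧ G.Adj r s := by
    rintro v r ⟨hr, hv, h | ⟨a, ha, h, -⟩ | ⟨a, ha, -, -, h, -⟩⟩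
    exacts [⟨v, hv, h⟩, ⟨a, ha, h⟩, ⟨a, ha, h⟩]
  have hρ2 : ∀ u ∈ S, ∀ v ∈ S, G.Adj u v → ρ u = ρ v := by
    intro u hu v hv huv
    have hP : P u = P v := by
      funext r
      exact propext ⟨fun h => ⟨h.1, mem_ball_of_adj hG h.2 hv huv⟩,
        fun h => ⟨h.1, mem_ball_of_adj hG h.2 hu huv.symm⟩⟩
    change @Classical.epsilon V ⟨u⟩ (P u) = @Classical.epsilon V ⟨v⟩ (P v)
    rw [hP]
  refine ⟨fun v => if ∃ s, s ∈ S ∧ G.Adj v s then φ (ρ v) v else c v, ?_, ?_⟩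
  · intro v hv
    dsimp only
    split_ifs with h
    · obtain ⟨s, hs, hvs⟩ := h
      have hP := hρ v hv s hs hvs
      exact (hφ _ hP.1 (hρ' _ _ hP)).1 v hP.2
    · exact hc v hv fun s hs hvs => h ⟨s, hs, hvs⟩
  · intro u hu v hv huv
    dsimp only
    rw [if_pos ⟨v, hv, huv⟩, if_pos ⟨u, hu, huv.symm⟩, hρ2 u hu v hv huv]
    have hP := hρ v hv u hu huv.symm
    exact (hφ _ hP.1 (hρ' _ _ hP)).2 u (mem_ball_of_adj hG hP.2 hu huv.symm) v hP.2 huv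

/-- Colourings of the classes combine to a colouring of `K`: an edge between two classes joins
vertices without a common colour. -/
theorem exists_isListColoring_of_firstNbr [Nonempty C] {m M : ℕ} {G : SimpleGraph V} {K : Set V}
    {L : C → Set V} {d : Fin m → V} {u : Fin M → V} {γ : Fin M → C}
    (hd : ∀ v, v ∈ K → ∃ i, G.Adj (d i) v)
    (h : ∀ i, ∃ φ : V → C, IsListColoring G (firstNbr G K d i)
      (separated G (trimmed G L u γ) (laterNbr G K d i)) φ) :
    ∃ φ : V → C, IsListColoring G K L φ := by
  classical
  choose φ hφ using h
  have hι : ∀ v, v ∈ K → ∃ i, v ∈ firstNbr G K d i := by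
    intro v hv
    obtain ⟨i, hi, hmin⟩ := WellFounded.has_min (wellFounded_lt (α := Fin m))
      {i | G.Adj (d i) v} (hd v hv)
    exact ⟨i, hv, hi, fun t ht h => hmin t h ht⟩
  choose! ι hι using fun v => show ∃ ψ : C, v ∈ K → ∃ i, v ∈ firstNbr G K d i ∧ ψ = φ i v by
    by_cases hv : v ∈ K
    · obtain ⟨i, hi⟩ := hι v hv
      exact ⟨φ i v, fun _ => ⟨i, hi, rfl⟩⟩
    · exact ⟨Classical.arbitrary C, fun h => absurd h hv⟩
  have hlt : ∀ i i' v v', v ∈ firstNbr G K d i → v' ∈ firstNbr G K d i' → i < i' → G.Adj v v' →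
      φ i v ≠ φ i' v' := by
    intro i i' v v' hv hv' hii hadj heq
    have h1 := ((hφ i).1 v hv).2 v' ⟨hv'.1, fun t ht => hv'.2.2 t (ht.trans_lt hii)⟩ hadj
    exact h1 (heq ▸ ((hφ i').1 v' hv').1)
  refine ⟨ι, ?_, ?_⟩
  · intro v hv
    obtain ⟨i, hi, he⟩ := hι v hv
    rw [he]
    exact ((hφ i).1 v hi).1.1
  · intro v hv v' hv' hadj
    obtain ⟨i, hi, he⟩ := hι v hv
    obtain ⟨i', hi', he'⟩ := hι v' hv'
    rw [he, he']
    rcases lt_trichotomy i i' with hlt' | rfl | hlt'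
    · exact hlt _ _ _ _ hi hi' hlt' hadj
    · exact (hφ i).2 v hi v' hi' hadj
    · exact (hlt _ _ _ _ hi' hi hlt' hadj.symm).symm

theorem Splits.exists_isListColoring [Fintype C] [Nonempty C] {m M : ℕ} {G : SimpleGraph V}
    (hG : P5Free G) : ∀ {j : ℕ} {S : Set V} {L : C → Set V}, Splits m M G j S L →
      ∃ φ : V → C, IsListColoring G S L φ
  | 0, _, _, h => ⟨fun _ => Classical.arbitrary C, fun v hv => absurd hv (h v),
      fun v hv => absurd hv (h v)⟩
  | j + 1, S, L, h => by
    refine exists_isListColoring_of_ball hG (fun r hr => (h r hr).1) fun r hr => ?_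
    obtain h' | ⟨d, u, γ, hd, hi⟩ := (h r hr).2
    · exact .inl h'
    · exact .inr (exists_isListColoring_of_firstNbr hd fun i => (hi i).exists_isListColoring hG)

/-- A minimal set `D ⊆ A` dominating `X` has a private neighbour in `X` for each of its members.
If the pairs of a vertex and a private neighbour are told apart by a function with values in `κ`,
then `D` has at most as many members as `κ`. -/
theorem exists_small_dominating [Finite V] (G : SimpleGraph V) (A X : Set V)
    (hdom : ∀ b ∈ X, ∃ a ∈ A, G.Adj a b) {κ : Type} [Fintype κ] (f : V → V → κ)
    (hf : ∀ a ∈ A, ∀ a' ∈ A, ∀ b ∈ X, ∀ b' ∈ X, G.Adj a b → G.Adj a' b' → ¬ G.Adj a b' →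
      ¬ G.Adj a' b → f a b ≠ f a' b') :
    ∃ D : Finset V, D.card ≤ Fintype.card κ ∧ (∀ a ∈ D, a ∈ A) ∧ ∀ b ∈ X, ∃ a ∈ D, G.Adj a b := by
  classical
  have := Fintype.ofFinite V
  let F : Set (Finset V) := {D | (∀ a ∈ D, a ∈ A) ∧ ∀ b ∈ X, ∃ a ∈ D, G.Adj a b}
  have hF : F.Nonempty := by
    refine ⟨Finset.univ.filter (· ∈ A), by simp, fun b hb => ?_⟩
    obtain ⟨a, ha, hab⟩ := hdom b hb
    exact ⟨a, by simpa using ha, hab⟩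
  obtain ⟨D, hD, hmin⟩ := WellFounded.has_min (wellFounded_lt (α := Finset V)) F hF
  refine ⟨D, ?_, hD⟩
  have hpriv : ∀ a : D, ∃ b ∈ X, G.Adj a b ∧ ∀ a' ∈ D, G.Adj a' b → a' = a := by
    rintro ⟨a, ha⟩
    by_contra! hcon
    refine hmin (D.erase a) ⟨fun x hx => hD.1 x (Finset.mem_of_mem_erase hx), fun b hb => ?_⟩
      (Finset.erase_ssubset ha)
    obtain ⟨x, hx, hxb⟩ := hD.2 b hb
    by_cases hxa : x = a
    · subst hxa
      obtain ⟨y, hy, hyb, hne⟩ := hcon b hb hxb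
      exact ⟨y, Finset.mem_erase.2 ⟨hne, hy⟩, hyb⟩
    · exact ⟨x, Finset.mem_erase.2 ⟨hxa, hx⟩, hxb⟩
  choose b hbX hab hpr using hpriv
  have hinj : Function.Injective fun a : D => f a (b a) := by
    intro a a' he
    by_contra hne
    refine hf a (hD.1 a a.2) a' (hD.1 a' a'.2) (b a) (hbX a) (b a') (hbX a') (hab a) (hab a')
      (fun h => hne (Subtype.ext (hpr a' a a.2 h)))
      (fun h => hne (Subtype.ext (hpr a a' a'.2 h)).symm) he
  simpa using Fintype.card_le_of_injective _ hinj

/-- In a `P₅`-free graph coloured by `φ`, the component of a vertex `r` with a neighbour `s` has a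
total dominating set of bounded size: `r`, `s`, a set of neighbours of `r` that dominates the
second level, and a set of vertices of the second level that dominates the third one. -/
theorem exists_total_dominating [Finite V] [Fintype C] {G : SimpleGraph V} (hG : P5Free G)
    {S : Set V} {φ : V → C} (hφ : ∀ u ∈ S, ∀ v ∈ S, G.Adj u v → φ u ≠ φ v) {r s : V} (hr : r ∈ S)
    (hs : s ∈ S) (hrs : G.Adj r s) :
    ∃ D : Finset V, D.card ≤ 2 + 2 * (Fintype.card C * Fintype.card C) ∧ (∀ d ∈ D, d ∈ S) ∧
      D.Nonempty ∧ ∀ v ∈ ball G S r, ∃ d ∈ D, G.Adj d v := by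
  classical
  let N₁ : Set V := {v | v ∈ S ∧ G.Adj r v}
  let N₂ : Set V := {v | v ∈ S ∧ ¬ G.Adj r v ∧ ∃ a ∈ N₁, G.Adj a v}
  let N₃ : Set V := {v | v ∈ S ∧ ¬ G.Adj r v ∧ (∀ a ∈ N₁, ¬ G.Adj a v) ∧ ∃ b ∈ N₂, G.Adj b v}
  obtain ⟨D₁, hc₁, hs₁, hd₁⟩ := exists_small_dominating G N₁ N₂ (fun b hb => hb.2.2)
    (fun a b => (φ a, φ b)) (by
      intro a ha a' ha' b hb b' hb' hab hab' nab nab' he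
      rw [Prod.mk.injEq] at he
      exact hG.elim hab.symm ha.2.symm ha'.2 hab' (fun h => hb.2.1 h.symm)
        (fun h => nab' h.symm) (fun h => hφ b hb.1 b' hb'.1 h he.2)
        (fun h => hφ a ha.1 a' ha'.1 h he.1) nab hb'.2.1)
  obtain ⟨D₂, hc₂, hs₂, hd₂⟩ := exists_small_dominating G N₂ N₃ (fun b hb => hb.2.2.2)
    (fun a b => (φ a, φ b)) (by
      intro a ha a' ha' b hb b' hb' hab hab' nab nab' he
      rw [Prod.mk.injEq] at he
      have naa : ¬ G.Adj a a' := fun h => hφ a ha.1 a' ha'.1 h he.1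
      have nbb : ¬ G.Adj b b' := fun h => hφ b hb.1 b' hb'.1 h he.2
      obtain ⟨p, hp, hpa⟩ := ha.2.2
      obtain ⟨p', hp', hpa'⟩ := ha'.2.2
      by_cases h1 : G.Adj p a'
      · exact hG.elim hab.symm hpa.symm h1 hab' (fun h => hb.2.2.1 p hp h.symm)
          (fun h => nab' h.symm) nbb naa nab (hb'.2.2.1 p hp)
      by_cases h2 : G.Adj p' a
      · exact hG.elim hab.symm h2.symm hpa' hab' (fun h => hb.2.2.1 p' hp' h.symm)
          (fun h => nab' h.symm) nbb naa nab (hb'.2.2.1 p' hp')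
      by_cases h3 : G.Adj p p'
      · exact hG.elim hab.symm hpa.symm h3 hpa' (fun h => hb.2.2.1 p hp h.symm)
          (fun h => hb.2.2.1 p' hp' h.symm) (fun h => nab' h.symm) (fun h => h2 h.symm) naa h1
      · exact hG.elim hab.symm hpa.symm hp.2.symm hp'.2 (fun h => hb.2.2.1 p hp h.symm)
          (fun h => hb.2.1 h.symm) (fun h => hb.2.2.1 p' hp' h.symm) (fun h => ha.2.1 h.symm)
          (fun h => h2 h.symm) h3)
  rw [Fintype.card_prod] at hc₁ hc₂
  refine ⟨{r, s} ∪ (D₁ ∪ D₂), ?_, ?_, ⟨r, by simp⟩, ?_⟩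
  · have h1 := Finset.card_union_le {r, s} (D₁ ∪ D₂)
    have h2 := Finset.card_union_le D₁ D₂
    have h3 := Finset.card_le_two (a := r) (b := s)
    omega
  · intro d hd
    simp only [Finset.mem_union, Finset.mem_insert, Finset.mem_singleton] at hd
    obtain (rfl | rfl) | h | h := hd
    exacts [hr, hs, (hs₁ d h).1, (hs₂ d h).1]
  · intro v hv
    by_cases h1 : G.Adj r v
    · exact ⟨r, by simp, h1⟩
    by_cases h2 : ∃ a ∈ N₁, G.Adj a v
    · obtain ⟨d, hd, hdv⟩ := hd₁ v ⟨hv.1, h1, h2⟩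
      exact ⟨d, by simp [hd], hdv⟩
    have h3 : v ∈ N₃ := by
      push Not at h2
      refine ⟨hv.1, h1, h2, ?_⟩
      obtain ⟨hvS, h | ⟨a, ha, hra, hav⟩ | ⟨a, ha, b, hb, hra, hab, hbv⟩⟩ := hv
      · exact absurd h h1
      · exact absurd hav (h2 a ⟨ha, hra⟩)
      · exact ⟨b, ⟨hb, fun h => h2 b ⟨hb, h⟩ hbv, a, ⟨ha, hra⟩, hab⟩, hbv⟩
    obtain ⟨d, hd, hdv⟩ := hd₂ v h3
    exact ⟨d, by simp [hd], hdv⟩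

theorem exists_fin_range_eq {α : Type} {D : Finset α} (hne : D.Nonempty) {m : ℕ}
    (hm : D.card ≤ m) : ∃ f : Fin m → α, ∀ x, x ∈ D ↔ ∃ i, f i = x := by
  classical
  obtain ⟨x₀, hx₀⟩ := hne
  refine ⟨fun i => if h : i.1 < D.card then D.equivFin.symm ⟨i, h⟩ else x₀, fun x => ⟨?_, ?_⟩⟩
  · intro hx
    refine ⟨⟨D.equivFin ⟨x, hx⟩, (D.equivFin ⟨x, hx⟩).2.trans_le hm⟩, ?_⟩
    simp
  · rintro ⟨i, rfl⟩
    dsimp only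
    split_ifs
    · exact Subtype.prop _
    · exact hx₀

/-- The number of dominating vertices that suffice for `k` colours. -/
def domSize (k : ℕ) : ℕ := 2 + 2 * (k * k)

/-- The number of coloured vertices that suffice for `k` colours. -/
def guessSize (k : ℕ) : ℕ := domSize k + domSize k * k * k

/-- A list colouring survives the removal of colours if the guess `u` consists of the `d i` and, for
every class and every colour `c`, of a bounded number of vertices of the class with colour `c` that
dominate all later vertices with a neighbour of colour `c` in the class. -/
theorem exists_guess [Finite V] [Fintype C] {m M : ℕ} {G : SimpleGraph V} (hG : P5Free G)
    {S K : Set V} (hKS : K ⊆ S) {L : C → Set V} {φ : V → C} (hφ : IsListColoring G S L φ)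
    (hm : 0 < m) (hM : m + m * Fintype.card C * Fintype.card C ≤ M) (d : Fin m → V)
    (hd : ∀ i, d i ∈ S) :
    ∃ u : Fin M → V, (∀ t, u t ∈ S) ∧
      (∀ i, ∃ t, u t = d i) ∧ ∀ i, IsListColoring G (firstNbr G K d i)
        (separated G (trimmed G L u (φ ∘ u)) (laterNbr G K d i)) φ := by
  classical
  have hA : ∀ (i : Fin m) (c : C), ∃ D : Finset V, D.card ≤ Fintype.card C ∧
      (∀ a ∈ D, a ∈ {v | v ∈ firstNbr G K d i ∧ φ v = c}) ∧
      ∀ b ∈ {b | b ∈ laterNbr G K d i ∧ ∃ a ∈ {v | v ∈ firstNbr G K d i ∧ φ v = c}, G.Adj a b},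
        ∃ a ∈ D, G.Adj a b := by
    intro i c
    refine exists_small_dominating G _ _ (fun b hb => hb.2) (fun _ b => φ b) ?_
    intro a ha a' ha' b hb b' hb' hab hab' nab nab' he
    exact hG.elim hab.symm ha.1.2.1.symm ha'.1.2.1 hab' (fun h => hb.1.2 i le_rfl h.symm)
      (fun h => nab' h.symm) (fun h => hφ.2 b (hKS hb.1.1) b' (hKS hb'.1.1) h he)
      (fun h => hφ.2 a (hKS ha.1.1) a' (hKS ha'.1.1) h (ha.2.trans ha'.2.symm)) nab
      (hb'.1.2 i le_rfl)
  choose D hDc hDs hDd using hA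
  let E : Finset V := Finset.univ.image d ∪
    (Finset.univ : Finset (Fin m × C)).biUnion fun p => D p.1 p.2
  have hE : E.card ≤ m + m * Fintype.card C * Fintype.card C := by
    refine (Finset.card_union_le _ _).trans (add_le_add ?_ ?_)
    · simpa using Finset.card_image_le (s := Finset.univ) (f := d)
    · refine (Finset.card_biUnion_le_card_mul _ _ (Fintype.card C) fun p _ => hDc _ _).trans ?_
      simp
  obtain ⟨u, hu⟩ := exists_fin_range_eq (D := E) ⟨d ⟨0, hm⟩, by simp [E]⟩ (hE.trans hM)
  have huS : ∀ t, u t ∈ S := by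
    intro t
    have := (hu (u t)).2 ⟨t, rfl⟩
    simp only [E, Finset.mem_union, Finset.mem_image, Finset.mem_univ, true_and,
      Finset.mem_biUnion] at this
    obtain ⟨i, hi⟩ | ⟨p, hp⟩ := this
    · exact hi ▸ hd i
    · exact hKS (hDs _ _ _ hp).1.1
  refine ⟨u, huS, fun i => (hu (d i)).1 (by simp [E]), fun i => ⟨?_, ?_⟩⟩
  · have htrim : ∀ v ∈ K, v ∈ trimmed G L u (φ ∘ u) (φ v) := fun v hv =>
      ⟨hφ.1 v (hKS hv), fun t ht h => hφ.2 _ (huS t) _ (hKS hv) h ht⟩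
    refine fun a ha => ⟨htrim a ha.1, fun b hb hab hbL => ?_⟩
    obtain ⟨w, hw, hwb⟩ := hDd i (φ a) b ⟨hb, a, ⟨ha, rfl⟩, hab⟩
    obtain ⟨t, rfl⟩ := (hu w).1 (by
      simp only [E, Finset.mem_union, Finset.mem_biUnion]
      exact .inr ⟨(i, φ a), Finset.mem_univ _, hw⟩)
    exact hbL.2 t (hDs _ _ _ hw).2 hwb
  · exact fun v hv w hw => hφ.2 v (hKS hv.1) w (hKS hw.1)

theorem IsListColoring.splits [Finite V] [Fintype C] {G : SimpleGraph V} (hG : P5Free G)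
    {φ : V → C} : ∀ {j : ℕ} {S : Set V} {L : C → Set V} (T : Finset C), T.card ≤ j →
      (∀ v ∈ S, ∀ c, v ∈ L c → c ∈ T) → IsListColoring G S L φ →
      Splits (domSize (Fintype.card C)) (guessSize (Fintype.card C)) G j S L
  | 0, S, L, T, hT, hLT, hφ => fun v hv => by
    have := hLT v hv _ (hφ.1 v hv)
    simp_all
  | j + 1, S, L, T, hT, hLT, hφ => by
    classical
    refine fun r hr => ⟨.inr ⟨_, hφ.1 r hr⟩, ?_⟩
    by_cases hiso : ∀ s, s ∈ S → ¬ G.Adj r s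
    · exact .inl hiso
    push Not at hiso
    obtain ⟨s, hs, hrs⟩ := hiso
    obtain ⟨D, hDc, hDS, hDne, hDd⟩ := exists_total_dominating hG hφ.2 hr hs hrs
    obtain ⟨d, hd⟩ := exists_fin_range_eq hDne (m := domSize (Fintype.card C)) hDc
    have hKS : ball G S r ⊆ S := fun v hv => hv.1
    have hdS : ∀ i, d i ∈ S := fun i => hDS _ ((hd _).2 ⟨i, rfl⟩)
    obtain ⟨u, huS, hud, hu⟩ := exists_guess (M := guessSize (Fintype.card C)) hG hKS hφ
      (by simp [domSize]) le_rfl d hdS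
    refine .inr ⟨d, u, φ ∘ u, fun v hv => ?_, fun i => ?_⟩
    · obtain ⟨x, hx, hxv⟩ := hDd v hv
      obtain ⟨i, rfl⟩ := (hd x).1 hx
      exact ⟨i, hxv⟩
    -- the colour of `d i` occurs no longer on the lists of its class
    refine IsListColoring.splits hG (T.erase (φ (d i))) ?_ ?_ (hu i)
    · rw [Finset.card_erase_of_mem (hLT _ (hdS i) _ (hφ.1 _ (hdS i)))]
      omega
    · intro v hv c hc
      refine Finset.mem_erase.2 ⟨?_, hLT v (hKS hv.1) c hc.1.1⟩
      rintro rfl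
      obtain ⟨t, ht⟩ := hud i
      exact hc.1.2 t (by simp [ht]) (ht ▸ hv.2.1)

/-- The criterion is correct if its depth is the number of all colours. -/
theorem splits_iff [Finite V] [Fintype C] {G : SimpleGraph V} (hG : P5Free G) (L : C → Set V) :
    Splits (domSize (Fintype.card C)) (guessSize (Fintype.card C)) G (Fintype.card C) Set.univ L ↔
      ∃ φ : V → C, IsListColoring G Set.univ L φ := by
  refine ⟨fun h => ?_, fun ⟨φ, hφ⟩ => hφ.splits hG Finset.univ (by simp) (by simp)⟩
  cases isEmpty_or_nonempty C with
  | inl hC =>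
    have hV : ∀ v : V, False := by
      rw [Fintype.card_eq_zero] at h
      exact fun v => h v trivial
    exact ⟨fun v => (hV v).elim, fun v => (hV v).elim, fun v => (hV v).elim⟩
  | inr hC => exact h.exists_isListColoring hG

end Graph

end P5Coloring

/-! ### First-order definability -/

namespace P5Coloring

/-- A graph on `0, …, n - 1` together with a partial colouring of its vertices. -/
structure Inst (C : Type) where
  /-- the number of vertices -/
  n : ℕ
  /-- the graph -/
  graph : SimpleGraph (Fin n)
  /-- the colours of the vertices that have one already; no properness is required -/
  col : Fin n → Option C

/-- The first-order definable relations on partially coloured graphs. A relation in `m` free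
variables is a predicate on the assignments `Fin m → Fin I.n`. -/
inductive FO {C : Type} : (m : ℕ) → ((I : Inst C) → (Fin m → Fin I.n) → Prop) → Prop
  | const {m : ℕ} (p : Prop) : FO m fun _ _ => p
  | adj {m : ℕ} (i j : Fin m) : FO m fun I e => I.graph.Adj (e i) (e j)
  | col {m : ℕ} (i : Fin m) (p : Option C → Prop) : FO m fun I e => p (I.col (e i))
  | not {m : ℕ} {P : (I : Inst C) → (Fin m → Fin I.n) → Prop} (h : FO m P) :
      FO m fun I e => ¬ P I e
  | and {m : ℕ} {P Q : (I : Inst C) → (Fin m → Fin I.n) → Prop} (hP : FO m P) (hQ : FO m Q) :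
      FO m fun I e => P I e ∧ Q I e
  | ex {m : ℕ} {P : (I : Inst C) → (Fin m → Fin I.n) → Fin I.n → Prop}
      (h : FO (m + 1) fun I e => P I (e ∘ Fin.castSucc) (e (Fin.last m))) :
      FO m fun I e => ∃ x, P I e x

variable {C : Type}

theorem FO.congr {m : ℕ} {P Q : (I : Inst C) → (Fin m → Fin I.n) → Prop} (h : FO m P)
    (hPQ : ∀ I e, P I e ↔ Q I e) : FO m Q := by
  obtain rfl : P = Q := by
    funext I e
    exact propext (hPQ I e)
  exact h

theorem FO.or {m : ℕ} {P Q : (I : Inst C) → (Fin m → Fin I.n) → Prop} (hP : FO m P)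
    (hQ : FO m Q) : FO m fun I e => P I e ∨ Q I e :=
  (hP.not.and hQ.not).not.congr fun I e => by tauto

theorem FO.imp {m : ℕ} {P Q : (I : Inst C) → (Fin m → Fin I.n) → Prop} (hP : FO m P)
    (hQ : FO m Q) : FO m fun I e => P I e → Q I e :=
  (hP.and hQ.not).not.congr fun I e => by tauto

theorem FO.all {m : ℕ} {P : (I : Inst C) → (Fin m → Fin I.n) → Fin I.n → Prop}
    (h : FO (m + 1) fun I e => P I (e ∘ Fin.castSucc) (e (Fin.last m))) :
    FO m fun I e => ∀ x, P I e x :=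
  (FO.ex (P := fun I e x => ¬ P I e x) h.not).not.congr fun I e => by push Not; rfl

theorem FO.existsFinite {m : ℕ} {ι : Type} [Finite ι]
    {P : ι → (I : Inst C) → (Fin m → Fin I.n) → Prop} (h : ∀ i, FO m (P i)) :
    FO m fun I e => ∃ i, P i I e := by
  classical
  have := Fintype.ofFinite ι
  have key : ∀ s : Finset ι, FO m fun I e => ∃ i ∈ s, P i I e := by
    intro s
    induction s using Finset.induction_on with
    | empty => exact (FO.const False).congr fun I e => by simp
    | insert a s _ ih => exact ((h a).or ih).congr fun I e => by simp
  exact (key Finset.univ).congr fun I e => by simp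

theorem FO.allFinite {m : ℕ} {ι : Type} [Finite ι]
    {P : ι → (I : Inst C) → (Fin m → Fin I.n) → Prop} (h : ∀ i, FO m (P i)) :
    FO m fun I e => ∀ i, P i I e :=
  (FO.existsFinite (P := fun i I e => ¬ P i I e) fun i => (h i).not).not.congr fun I e => by
    push Not; rfl

/-- A bounded number of vertices can be quantified at once. -/
theorem FO.exTuple {m M : ℕ} {P : (I : Inst C) → (Fin m → Fin I.n) → (Fin M → Fin I.n) → Prop}
    (h : FO (m + M) fun I e => P I (e ∘ Fin.castAdd M) (e ∘ Fin.natAdd m)) :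
    FO m fun I e => ∃ w, P I e w := by
  induction M with
  | zero =>
    refine h.congr fun I e => ⟨fun h => ⟨_, h⟩, fun ⟨w, h⟩ => ?_⟩
    rw [Subsingleton.elim w (e ∘ Fin.natAdd m)] at h
    exact h
  | succ M ih =>
    refine (ih (P := fun I e w => ∃ x, P I e (Fin.snoc w x)) (FO.ex ?_)).congr fun I e => ?_
    · refine h.congr fun I e => ?_
      have h2 : (e ∘ Fin.natAdd m : Fin (M + 1) → Fin I.n) =
          Fin.snoc ((e ∘ Fin.castSucc) ∘ Fin.natAdd m) (e (Fin.last (m + M))) := by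
        funext t
        refine Fin.lastCases ?_ (fun t => ?_) t
        · rw [Fin.snoc_last]; rfl
        · rw [Fin.snoc_castSucc]; rfl
      rw [h2]
      rfl
    · constructor
      · rintro ⟨w, x, hx⟩
        exact ⟨_, hx⟩
      · rintro ⟨w, hw⟩
        exact ⟨Fin.init w, w (Fin.last M), by rwa [Fin.snoc_init_self]⟩

/-- A set depending on `m` parameters is definable if membership in it is first-order in every
context in which the parameters are among the free variables. -/
def Definable (m : ℕ) (S : (I : Inst C) → (Fin m → Fin I.n) → Set (Fin I.n)) : Prop :=
  ∀ (m' : ℕ) (ρ : Fin m → Fin m') (x : Fin m'), FO m' fun I e => e x ∈ S I (e ∘ ρ)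

namespace Definable

variable {m a : ℕ} {S K : (I : Inst C) → (Fin m → Fin I.n) → Set (Fin I.n)}
  {L : C → (I : Inst C) → (Fin m → Fin I.n) → Set (Fin I.n)}

theorem rename (hS : Definable m S) {m' : ℕ} (ρ : Fin m → Fin m') :
    Definable m' fun I e => S I (e ∘ ρ) := fun m'' ρ' x => hS m'' (ρ' ∘ ρ) x

theorem ball (hS : Definable m S) (r : Fin m) :
    Definable m fun I e => ball I.graph (S I e) (e r) := by
  intro m' ρ x
  simp only [P5Coloring.ball, Set.mem_ofPred_eq]
  refine (hS _ ρ x).and (.or (.adj _ _) (.or (.ex ?_) (.ex ?_)))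
  · exact (hS _ (Fin.castSucc ∘ ρ) (Fin.last _)).and
      (.and (.adj (Fin.castSucc (ρ r)) (Fin.last _)) (.adj (Fin.last _) (Fin.castSucc x)))
  · refine (hS _ (Fin.castSucc ∘ ρ) (Fin.last _)).and (.ex ?_)
    exact (hS _ (Fin.castSucc ∘ Fin.castSucc ∘ ρ) (Fin.last _)).and
      (.and (.adj (Fin.castSucc (Fin.castSucc (ρ r))) (Fin.castSucc (Fin.last _)))
        (.and (.adj (Fin.castSucc (Fin.last _)) (Fin.last _))
          (.adj (Fin.last _) (Fin.castSucc (Fin.castSucc x)))))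

theorem firstNbr (hK : Definable m K) (d : Fin a → Fin m) (i : Fin a) :
    Definable m fun I e => firstNbr I.graph (K I e) (e ∘ d) i := by
  intro m' ρ x
  simp only [P5Coloring.firstNbr, Set.mem_ofPred_eq]
  exact (hK _ ρ x).and (.and (.adj (ρ (d i)) x)
    (.allFinite fun t => .imp (.const _) (.not (.adj (ρ (d t)) x))))

theorem laterNbr (hK : Definable m K) (d : Fin a → Fin m) (i : Fin a) :
    Definable m fun I e => laterNbr I.graph (K I e) (e ∘ d) i := by
  intro m' ρ x
  simp only [P5Coloring.laterNbr, Set.mem_ofPred_eq]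
  exact (hK _ ρ x).and (.allFinite fun t => .imp (.const _) (.not (.adj (ρ (d t)) x)))

theorem trimmed (hL : ∀ c, Definable m (L c)) (u : Fin a → Fin m) (γ : Fin a → C) (c : C) :
    Definable m fun I e => trimmed I.graph (fun c => L c I e) (e ∘ u) γ c := by
  intro m' ρ x
  simp only [P5Coloring.trimmed, Set.mem_ofPred_eq]
  exact (hL c _ ρ x).and (.allFinite fun t => .imp (.const _) (.not (.adj (ρ (u t)) x)))

theorem separated (hL : ∀ c, Definable m (L c)) (hK : Definable m K) (c : C) :
    Definable m fun I e => separated I.graph (fun c => L c I e) (K I e) c := by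
  intro m' ρ x
  simp only [P5Coloring.separated, Set.mem_ofPred_eq]
  refine (hL c _ ρ x).and (.all ?_)
  exact .imp (hK _ (Fin.castSucc ∘ ρ) (Fin.last _)) (.imp (.adj (Fin.castSucc x) (Fin.last _))
    (.not (hL c _ (Fin.castSucc ∘ ρ) (Fin.last _))))

end Definable

theorem Splits.fo [Fintype C] (a b : ℕ) : ∀ (j : ℕ) {m : ℕ}
    {S : (I : Inst C) → (Fin m → Fin I.n) → Set (Fin I.n)}
    {L : C → (I : Inst C) → (Fin m → Fin I.n) → Set (Fin I.n)}, Definable m S →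
    (∀ c, Definable m (L c)) → FO m fun I e => Splits a b I.graph j (S I e) fun c => L c I e
  | 0, m, S, L, hS, hL => by
    simp only [Splits]
    exact .all (.not (hS _ Fin.castSucc (Fin.last _)))
  | j + 1, m, S, L, hS, hL => by
    simp only [Splits]
    refine .all (.imp (hS _ Fin.castSucc (Fin.last _)) (.and (.or ?_ ?_) (.or ?_ ?_)))
    · exact .ex (.and (hS _ (Fin.castSucc ∘ Fin.castSucc) (Fin.last _))
        (.adj (Fin.castSucc (Fin.last _)) (Fin.last _)))
    · exact .existsFinite fun c => hL c _ Fin.castSucc (Fin.last _)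
    · exact .all (.imp (hS _ (Fin.castSucc ∘ Fin.castSucc) (Fin.last _))
        (.not (.adj (Fin.castSucc (Fin.last _)) (Fin.last _))))
    · -- the context consists of the parameters, `r`, the tuple `d` and the tuple `u`
      refine .exTuple (.exTuple (.existsFinite fun γ => ?_))
      have hS' : Definable (m + 1 + a + b) fun I e =>
          S I (e ∘ Fin.castAdd b ∘ Fin.castAdd a ∘ Fin.castSucc) := hS.rename _
      have hL' : ∀ c, Definable (m + 1 + a + b) fun I e =>
          L c I (e ∘ Fin.castAdd b ∘ Fin.castAdd a ∘ Fin.castSucc) := fun c => (hL c).rename _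
      have hB := hS'.ball (Fin.castAdd b (Fin.castAdd a (Fin.last m)))
      have hd := hB.firstNbr (Fin.castAdd b ∘ Fin.natAdd (m + 1))
      have hl := hB.laterNbr (Fin.castAdd b ∘ Fin.natAdd (m + 1))
      have ht := Definable.trimmed hL' (Fin.natAdd (m + 1 + a)) γ
      refine .and (.all (.imp (hB _ Fin.castSucc (Fin.last _)) (.existsFinite fun i => ?_)))
        (.allFinite fun i => ?_)
      · exact .adj (Fin.castSucc (Fin.castAdd b (Fin.natAdd (m + 1) i))) (Fin.last _)
      · exact Splits.fo a b j (hd i) fun c => Definable.separated ht (hl i) c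

/-- Some proper colouring extends the partial colouring of the instance. -/
def Extendable (I : Inst C) : Prop :=
  ∃ φ : Fin I.n → C, (∀ v, I.col v = none ∨ I.col v = some (φ v)) ∧
    ∀ u v, I.graph.Adj u v → φ u ≠ φ v

/-- On `P₅`-free graphs, extendability of a partial colouring is first-order. -/
theorem exists_fo_extendable (C : Type) [Fintype C] (m : ℕ) :
    ∃ P : (I : Inst C) → (Fin m → Fin I.n) → Prop, FO m P ∧
      ∀ I e, P5Free I.graph → (P I e ↔ Extendable I) := by
  refine ⟨fun I _ => Splits (domSize (Fintype.card C)) (guessSize (Fintype.card C)) I.graph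
    (Fintype.card C) Set.univ fun c => {v | I.col v = none ∨ I.col v = some c},
    Splits.fo _ _ _ (S := fun _ _ => Set.univ)
      (L := fun c I _ => {v | I.col v = none ∨ I.col v = some c}) ?_ fun c => ?_, ?_⟩
  · exact fun m' ρ x => (FO.const True).congr fun I e => by simp
  · exact fun m' ρ x => .col x fun o => o = none ∨ o = some c
  · intro I e hG
    refine (splits_iff hG _).trans ?_
    simp [Extendable, IsListColoring]

end P5Coloring

/-! ### Structured programs on stacks -/

namespace P5Coloring

section Prog

variable {K : Type} {Γ : K → Type} {σ : Type}

/-- Structured programs acting on an internal state in `σ` and on stacks indexed by `K`. The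
instruction `loop k f b p` pops an element from stack `k`, updating the state by `f`, and leaves
the loop unless the new state satisfies `b`; otherwise it runs `p` and starts again. -/
inductive Prog (Γ : K → Type) (σ : Type) : Type
  | push (k : K) (f : σ → Γ k)
  | pop (k : K) (f : σ → Option (Γ k) → σ)
  | load (f : σ → σ)
  | seq (p q : Prog Γ σ)
  | ite (b : σ → Bool) (p q : Prog Γ σ)
  | loop (k : K) (f : σ → Option (Γ k) → σ) (b : σ → Bool) (p : Prog Γ σ)

/-- `Exec p v S v' S' t`: from state `v` and stacks `S`, the program `p` terminates after `t`
steps in state `v'` and stacks `S'`. -/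
inductive Exec [DecidableEq K] : Prog Γ σ → σ → (∀ k, List (Γ k)) → σ → (∀ k, List (Γ k)) → ℕ →
    Prop
  | push (k f v S) : Exec (.push k f) v S v (Function.update S k (f v :: S k)) 1
  | pop (k f v S) :
      Exec (.pop k f) v S (f v (S k).head?) (Function.update S k (S k).tail) 1
  | load (f v S) : Exec (.load f) v S (f v) S 1
  | seq {p q v S v' S' v'' S'' t t'} (hp : Exec p v S v' S' t) (hq : Exec q v' S' v'' S'' t') :
      Exec (.seq p q) v S v'' S'' (t' + t)
  | ite_true {b p q v S v' S' t} (hb : b v = true) (hp : Exec p v S v' S' t) :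
      Exec (.ite b p q) v S v' S' (t + 1)
  | ite_false {b p q v S v' S' t} (hb : b v = false) (hq : Exec q v S v' S' t) :
      Exec (.ite b p q) v S v' S' (t + 1)
  | loop_done {k f b p v S} (hb : b (f v (S k).head?) = false) :
      Exec (.loop k f b p) v S (f v (S k).head?) (Function.update S k (S k).tail) 1
  | loop_step {k f b p v S v' S' v'' S'' t t'} (hb : b (f v (S k).head?) = true)
      (hp : Exec p (f v (S k).head?) (Function.update S k (S k).tail) v' S' t)
      (hl : Exec (.loop k f b p) v' S' v'' S'' t') : Exec (.loop k f b p) v S v'' S'' (t' + t + 1)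

namespace Prog

/-- The program points of a program. -/
def Label : Prog Γ σ → Type
  | push _ _ => Unit
  | pop _ _ => Unit
  | load _ => Unit
  | seq p q => Label p ⊕ Label q
  | ite _ p q => Option (Label p ⊕ Label q)
  | loop _ _ _ p => Option (Label p)

instance finite_label : ∀ p : Prog Γ σ, Finite (Label p)
  | push _ _ => inferInstanceAs (Finite Unit)
  | pop _ _ => inferInstanceAs (Finite Unit)
  | load _ => inferInstanceAs (Finite Unit)
  | seq p q =>
    have := finite_label p
    have := finite_label q
    inferInstanceAs (Finite (Label p ⊕ Label q))
  | ite _ p q =>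
    have := finite_label p
    have := finite_label q
    inferInstanceAs (Finite (Option (Label p ⊕ Label q)))
  | loop _ _ _ p =>
    have := finite_label p
    inferInstanceAs (Finite (Option (Label p)))

/-- The program point at which a program starts. -/
def entry : (p : Prog Γ σ) → Label p
  | push _ _ => ()
  | pop _ _ => ()
  | load _ => ()
  | seq p _ => Sum.inl (entry p)
  | ite _ _ _ => none
  | loop _ _ _ _ => none

open Turing.TM2 in
/-- The statements of a `TM2` machine that carries out a program as a part of itself: the program
points are labels of the machine by way of `emb`, and `exit` is the label at which the machine
goes on. -/
def code {Λ : Type} : (p : Prog Γ σ) → (Label p → Λ) → Λ → Label p → Stmt Γ Λ σ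
  | push k f, _, exit, _ => .push k f (.goto fun _ => exit)
  | pop k f, _, exit, _ => .pop k f (.goto fun _ => exit)
  | load f, _, exit, _ => .load f (.goto fun _ => exit)
  | seq p q, emb, _, Sum.inl l => code p (fun l => emb (Sum.inl l)) (emb (Sum.inr (entry q))) l
  | seq _ q, emb, exit, Sum.inr l => code q (fun l => emb (Sum.inr l)) exit l
  | ite b p q, emb, _, none => .branch b (.goto fun _ => emb (some (Sum.inl (entry p))))
      (.goto fun _ => emb (some (Sum.inr (entry q))))
  | ite _ p _, emb, exit, some (Sum.inl l) => code p (fun l => emb (some (Sum.inl l))) exit l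
  | ite _ _ q, emb, exit, some (Sum.inr l) => code q (fun l => emb (some (Sum.inr l))) exit l
  | loop k f b p, emb, exit, none =>
      .pop k f (.branch b (.goto fun _ => emb (some (entry p))) (.goto fun _ => exit))
  | loop _ _ _ p, emb, _, some l => code p (fun l => emb (some l)) (emb none) l

end Prog

variable [DecidableEq K]

/-- A machine that contains the code of `p` simulates `p` step by step. -/
theorem Exec.iterate_step {Λ : Type} {M : Λ → Turing.TM2.Stmt Γ Λ σ} {p : Prog Γ σ} {v v' : σ}
    {S S' : ∀ k, List (Γ k)} {t : ℕ} (h : Exec p v S v' S' t) :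
    ∀ {emb : p.Label → Λ} {exit : Λ}, (∀ l, M (emb l) = p.code emb exit l) →
      (flip bind (Turing.TM2.step M))^[t] (some ⟨some (emb p.entry), v, S⟩) =
        some ⟨some exit, v', S'⟩ := by
  induction h with
  | push k f v S => intro emb exit hM; simp [flip, hM, Prog.code]
  | pop k f v S => intro emb exit hM; simp [flip, hM, Prog.code]
  | load f v S => intro emb exit hM; simp [flip, hM, Prog.code]
  | seq hp hq ihp ihq =>
    intro emb exit hM
    rw [Function.iterate_add_apply]
    have h1 := ihp (emb := fun l => emb (Sum.inl l)) fun l => hM (Sum.inl l)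
    have h2 := ihq (emb := fun l => emb (Sum.inr l)) fun l => hM (Sum.inr l)
    exact (congrArg _ h1).trans h2
  | @ite_true b p q v _ _ _ _ hb hp ihp =>
    intro emb exit hM
    have h1 := ihp (emb := fun l => emb (some (Sum.inl l))) fun l => hM (some (Sum.inl l))
    rw [Function.iterate_succ_apply, ← h1]
    have h0 := hM none
    simp only [Prog.code] at h0
    simp [flip, Prog.entry, h0, hb]
  | @ite_false b p q v _ _ _ _ hb hq ihq =>
    intro emb exit hM
    have h1 := ihq (emb := fun l => emb (some (Sum.inr l))) fun l => hM (some (Sum.inr l))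
    rw [Function.iterate_succ_apply, ← h1]
    have h0 := hM none
    simp only [Prog.code] at h0
    simp [flip, Prog.entry, h0, hb]
  | loop_done hb =>
    intro emb exit hM
    have h0 := hM none
    simp only [Prog.code] at h0
    simp [flip, Prog.entry, h0, hb]
  | loop_step hb hp hl ihp ihl =>
    intro emb exit hM
    have h1 := ihp (emb := fun l => emb (some l)) fun l => hM (some l)
    have h2 := ihl hM
    rw [Function.iterate_succ_apply, Function.iterate_add_apply, ← h2]
    congr 1
    refine Eq.trans ?_ h1
    have h0 := hM none
    simp only [Prog.code] at h0
    simp [flip, Prog.entry, h0, hb]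

open Classical in
/-- The machine that carries out the program `p` and halts. -/
noncomputable def Prog.machine [Fintype K] [Fintype σ] (p : Prog Γ σ) (k₀ k₁ : K)
    [Fintype (Γ k₀)] (v₀ : σ) : Turing.FinTM2 where
  K := K
  kDecidableEq := inferInstance
  kFin := inferInstance
  k₀ := k₀
  k₁ := k₁
  Γ := Γ
  Λ := Option p.Label
  main := some p.entry
  ΛFin := Fintype.ofFinite _
  σ := σ
  initialState := v₀
  σFin := inferInstance
  Γk₀Fin := inferInstance
  m
    | none => .halt
    | some l => p.code some none l

theorem Exec.outputsInTime [Fintype K] [Fintype σ] {p : Prog Γ σ} {k₀ k₁ : K} [Fintype (Γ k₀)]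
    {v₀ : σ} {S S' : ∀ k, List (Γ k)} {t b : ℕ} (h : Exec p v₀ S v₀ S' t) (hb : t < b)
    {l : List (Γ k₀)} {l' : List (Γ k₁)} (hS : S = (Turing.initList (p.machine k₀ k₁ v₀) l).stk)
    (hS' : S' = (Turing.haltList (p.machine k₀ k₁ v₀) l').stk) :
    Nonempty (Turing.TM2OutputsInTime (p.machine k₀ k₁ v₀) l (some l') b) := by
  refine ⟨⟨⟨t + 1, ?_⟩, hb⟩⟩
  have := h.iterate_step (M := (p.machine k₀ k₁ v₀).m) (emb := some) (exit := none) fun l => rfl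
  rw [Function.iterate_succ_apply']
  subst hS hS'
  exact congrArg _ this

end Prog

end P5Coloring

/-! ### Programs on the work stacks -/

namespace P5Coloring

/-- The symbols on the work stacks: the entries of the adjacency matrix and, in a last column, the
colours of the vertices that have one. -/
abbrev Sym (C : Type) : Type := Bool ⊕ Option C

/-- The work stacks: `mat` and `aux` hold the matrix to the right and to the left of the current
position. A number attached to `j` is the height of the stack `lo j`, while the height of `hi j`
counts down as this number grows, and `tp j` keeps the tokens of `lo j` during a loop. -/
inductive Work (J : Type) : Type
  | mat
  | aux
  | lo (j : J)
  | hi (j : J)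
  | tp (j : J)
  deriving DecidableEq, Fintype

/-- All stacks: input, output and work stacks. -/
inductive Stk (J : Type) : Type
  | inp
  | out
  | wk (w : Work J)
  deriving DecidableEq, Fintype

/-- The alphabets of the stacks. -/
abbrev Alph (C J : Type) : Stk J → Type
  | .inp => Computability.Γ'
  | .out => Bool ⊕ C
  | .wk _ => Sym C

/-- The internal states: a flag, which holds the result of a test, and a register for the symbol
read last. -/
abbrev St (C : Type) : Type := Bool × Option (Sym C)

/-- The symbol that counters are made of. -/
abbrev tok {C : Type} : Sym C := Sum.inl false

/-- A counter of the given value. -/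
abbrev rep {C : Type} (n : ℕ) : List (Sym C) := List.replicate n tok

section

variable {C J : Type}

/-- The contents of all stacks. -/
def stk (i : List Computability.Γ') (o : List (Bool ⊕ C)) (W : Work J → List (Sym C)) :
    ∀ k, List (Alph C J k)
  | .inp => i
  | .out => o
  | .wk w => W w

/-- The contents of the work stacks. -/
def mem (m x : List (Sym C)) (lo hi tp : J → List (Sym C)) : Work J → List (Sym C)
  | .mat => m
  | .aux => x
  | .lo j => lo j
  | .hi j => hi j
  | .tp j => tp j

variable [DecidableEq J]

theorem update_stk_wk (i : List Computability.Γ') (o : List (Bool ⊕ C)) (W : Work J → List (Sym C))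
    (w : Work J) (l : List (Sym C)) :
    Function.update (stk i o W) (.wk w) l = stk i o (Function.update W w l) := by
  funext k
  rcases k with _ | _ | w'
  · exact Function.update_of_ne (by simp) _ _
  · exact Function.update_of_ne (by simp) _ _
  · by_cases h : w' = w
    · subst h
      exact (Function.update_self ..).trans
        (Function.update_self (β := fun _ => List (Sym C)) ..).symm
    · exact (Function.update_of_ne (by simpa using h) _ _).trans
        (Function.update_of_ne (β := fun _ => List (Sym C)) h _ _).symm

theorem update_stk_inp (i : List Computability.Γ') (o : List (Bool ⊕ C))
    (W : Work J → List (Sym C)) (l : List Computability.Γ') :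
    Function.update (stk i o W) .inp l = stk l o W := by
  funext k
  rcases k with _ | _ | w'
  · exact Function.update_self ..
  · exact Function.update_of_ne (by simp) _ _
  · exact Function.update_of_ne (by simp) _ _

theorem update_stk_out (i : List Computability.Γ') (o : List (Bool ⊕ C))
    (W : Work J → List (Sym C)) (l : List (Bool ⊕ C)) :
    Function.update (stk i o W) .out l = stk i l W := by
  funext k
  rcases k with _ | _ | w'
  · exact Function.update_of_ne (by simp) _ _
  · exact Function.update_self ..
  · exact Function.update_of_ne (by simp) _ _

variable (m x : List (Sym C)) (lo hi tp : J → List (Sym C)) (l : List (Sym C)) (j : J)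

theorem update_mem_mat : Function.update (mem m x lo hi tp) .mat l = mem l x lo hi tp := by
  funext w
  rcases w with _ | _ | w | w | w <;> simp [mem]

theorem update_mem_aux : Function.update (mem m x lo hi tp) .aux l = mem m l lo hi tp := by
  funext w
  rcases w with _ | _ | w | w | w <;> simp [mem]

theorem update_mem_lo :
    Function.update (mem m x lo hi tp) (.lo j) l = mem m x (Function.update lo j l) hi tp := by
  funext w
  rcases w with _ | _ | w | w | w <;> simp [Function.update_apply, mem]

theorem update_mem_hi :
    Function.update (mem m x lo hi tp) (.hi j) l = mem m x lo (Function.update hi j l) tp := by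
  funext w
  rcases w with _ | _ | w | w | w <;> simp [Function.update_apply, mem]

theorem update_mem_tp :
    Function.update (mem m x lo hi tp) (.tp j) l = mem m x lo hi (Function.update tp j l) := by
  funext w
  rcases w with _ | _ | w | w | w <;> simp [Function.update_apply, mem]

end

section Do

variable {C J : Type} [DecidableEq J]

/-- Programs on the stacks of the colouring machine. -/
abbrev WProg (C J : Type) : Type := Prog (Alph C J) (St C)

/-- From state `v` and stacks `S`, the program terminates in state `v'` and stacks `S'` after at
most `b` steps. -/
def Runs (p : WProg C J) (v : St C) (S : ∀ k, List (Alph C J k)) (v' : St C)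
    (S' : ∀ k, List (Alph C J k)) (b : ℕ) : Prop :=
  ∃ t ≤ b, Exec p v S v' S' t

/-- Whatever the register holds, the program turns the flag `a` and the stacks `S` into `a'` and
`S'` in at most `b` steps. -/
def Do (p : WProg C J) (a : Bool) (S : ∀ k, List (Alph C J k)) (a' : Bool)
    (S' : ∀ k, List (Alph C J k)) (b : ℕ) : Prop :=
  ∀ r, ∃ r', Runs p (a, r) S (a', r') S' b

variable {p q : WProg C J} {v v' v'' : St C} {S S' S'' : ∀ k, List (Alph C J k)}
  {a a' a'' : Bool} {b b' : ℕ} {i : List Computability.Γ'} {o : List (Bool ⊕ C)}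
  {W W' W'' : Work J → List (Sym C)}

theorem Runs.mono (h : Runs p v S v' S' b) (hb : b ≤ b') : Runs p v S v' S' b' :=
  let ⟨t, ht, he⟩ := h
  ⟨t, ht.trans hb, he⟩

theorem Runs.seq (h : Runs p v S v' S' b) (h' : Runs q v' S' v'' S'' b') :
    Runs (.seq p q) v S v'' S'' (b' + b) :=
  let ⟨_, ht, he⟩ := h
  let ⟨_, ht', he'⟩ := h'
  ⟨_, add_le_add ht' ht, .seq he he'⟩

theorem Do.mono (h : Do p a S a' S' b) (hb : b ≤ b') : Do p a S a' S' b' := fun r =>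
  let ⟨r', h⟩ := h r
  ⟨r', h.mono hb⟩

theorem Do.congr {i' o'} (h : Do p a S a' (stk i' o' W) b) (hW : ∀ w, W w = W' w) :
    Do p a S a' (stk i' o' W') b := funext hW ▸ h

theorem Do.seq (h : Do p a S a' S' b) (h' : Do q a' S' a'' S'' b') :
    Do (.seq p q) a S a'' S'' (b' + b) := fun r =>
  let ⟨r', h⟩ := h r
  let ⟨r'', h'⟩ := h' r'
  ⟨r'', h.seq h'⟩

theorem Do.ite_true (h : Do p true S a' S' b) : Do (.ite Prod.fst p q) true S a' S' (b + 1) :=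
  fun r =>
  let ⟨r', _, ht, he⟩ := h r
  ⟨r', _, Nat.succ_le_succ ht, .ite_true rfl he⟩

theorem Do.ite_false (h : Do q false S a' S' b) : Do (.ite Prod.fst p q) false S a' S' (b + 1) :=
  fun r =>
  let ⟨r', _, ht, he⟩ := h r
  ⟨r', _, Nat.succ_le_succ ht, .ite_false rfl he⟩

/-- Do nothing. -/
def skip : WProg C J := .load id

theorem Do.skip : Do (skip : WProg C J) a S a S 1 := fun r => ⟨r, _, le_rfl, .load _ _ _⟩

/-- Set the flag to a function of itself. -/
def setFlag (f : Bool → Bool) : WProg C J := .load fun v => (f v.1, v.2)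

theorem Do.setFlag (f : Bool → Bool) : Do (setFlag f : WProg C J) a S (f a) S 1 := fun r =>
  ⟨r, _, le_rfl, .load _ _ _⟩

/-- Pop a symbol from a work stack into the register. -/
def popW (w : Work J) : WProg C J := .pop (.wk w) fun v s => (v.1, s)

theorem Runs.popW (w : Work J) : Runs (popW w : WProg C J) v (stk i o W) (v.1, (W w).head?)
    (stk i o (Function.update W w (W w).tail)) 1 := by
  rw [← update_stk_wk]
  exact ⟨1, le_rfl, .pop _ _ _ _⟩

/-- Push the register onto a work stack. -/
def pushW (w : Work J) : WProg C J := .push (.wk w) fun v => v.2.getD tok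

theorem Runs.pushW (w : Work J) (a : Bool) (s : Sym C) :
    Runs (pushW w : WProg C J) (a, some s) (stk i o W) (a, some s)
    (stk i o (Function.update W w (s :: W w))) 1 := by
  rw [← update_stk_wk]
  exact ⟨1, le_rfl, .push _ _ _ _⟩

/-- Push a counter token onto a work stack. -/
def pushTok (w : Work J) : WProg C J := .push (.wk w) fun _ => tok

theorem Do.pushTok (w : Work J) :
    Do (pushTok w : WProg C J) a (stk i o W) a (stk i o (Function.update W w (tok :: W w))) 1 := by
  intro r
  rw [← update_stk_wk]
  exact ⟨r, 1, le_rfl, .push _ _ _ _⟩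

/-- Pop symbols from a work stack until it is empty, and run `p` after each of them. -/
def each (w : Work J) (p : WProg C J) : WProg C J :=
  .loop (.wk w) (fun v s => (v.1, s)) (fun v => v.2.isSome) p

/-- The loop rule: `Inv t` is what holds before the iteration with number `t`. -/
theorem Do.exists_each {w : Work J} {N : ℕ} (Inv : ℕ → Bool → (∀ k, List (Alph C J k)) → Prop)
    (hstep : ∀ t < N, ∀ a S, Inv t a S → ∃ i o W s l, S = stk i o W ∧ W w = s :: l ∧
      ∃ a' r' S', Inv (t + 1) a' S' ∧
        Runs p (a, some s) (stk i o (Function.update W w l)) (a', r') S' b)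
    (hend : ∀ a S, Inv N a S → S (.wk w) = []) (h0 : Inv 0 a S) :
    ∃ a' S', Inv N a' S' ∧ Do (each w p) a S a' S' (N * (b + 1) + 1) := by
  induction N generalizing Inv a S with
  | zero =>
    refine ⟨a, S, h0, fun r => ⟨none, 1, by simp, ?_⟩⟩
    have hS := hend a S h0
    have h := Exec.loop_done (Γ := Alph C J) (k := .wk w) (f := fun (v : St C) s => (v.1, s))
      (b := fun v => v.2.isSome) (p := p) (v := (a, r)) (S := S) (by rw [hS]; rfl)
    rwa [hS, List.tail_nil, ← hS, Function.update_eq_self, hS] at h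
  | succ N ih =>
    obtain ⟨i, o, W, s, l, rfl, hW, a₁, r₁, S₁, h1, t, ht, he⟩ := hstep 0 (by omega) a S h0
    obtain ⟨a', S', hN, hdo⟩ := ih (fun t => Inv (t + 1))
      (fun t ht => hstep (t + 1) (by omega)) hend h1
    refine ⟨a', S', hN, fun r => ?_⟩
    obtain ⟨r', t', ht', he'⟩ := hdo r₁
    refine ⟨r', t' + t + 1, ?_, ?_⟩
    · rw [Nat.succ_mul]; omega
    · have hS : stk i o W (.wk w) = s :: l := hW
      refine Exec.loop_step (by rw [hS]; rfl) ?_ he'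
      rw [hS, update_stk_wk]
      exact he

/-- The loop rule for a loop whose course is determined. -/
theorem Do.each {w : Work J} {N : ℕ} (A : ℕ → Bool) (T : ℕ → ∀ k, List (Alph C J k))
    (hstep : ∀ t < N, ∃ i o W s l, T t = stk i o W ∧ W w = s :: l ∧
      ∃ r', Runs p (A t, some s) (stk i o (Function.update W w l)) (A (t + 1), r') (T (t + 1)) b)
    (hend : T N (.wk w) = []) : Do (each w p) (A 0) (T 0) (A N) (T N) (N * (b + 1) + 1) := by
  obtain ⟨_, _, ⟨rfl, rfl⟩, h⟩ := Do.exists_each (p := p) (b := b) (w := w) (N := N)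
    (fun t a S => a = A t ∧ S = T t) (by
      rintro t ht _ _ ⟨rfl, rfl⟩
      obtain ⟨i, o, W, s, l, h1, h2, r', h3⟩ := hstep t ht
      exact ⟨i, o, W, s, l, h1, h2, _, r', _, ⟨rfl, rfl⟩, h3⟩)
    (by rintro _ _ ⟨rfl, rfl⟩; exact hend) ⟨rfl, rfl⟩
  exact h

/-- Move the symbols of a work stack to another one. -/
def move (w w' : Work J) : WProg C J := each w (pushW w')

theorem Do.move {w w' : Work J} (hw : w ≠ w') {n : ℕ} (hn : (W w).length ≤ n) :
    Do (move w w') a (stk i o W) a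
      (stk i o (Function.update (Function.update W w' ((W w).reverse ++ W w')) w []))
      (2 * n + 1) := by
  generalize hl : W w = l at hn ⊢
  have h := Do.each (p := pushW w') (w := w) (N := l.length) (b := 1) (fun _ => a)
    (fun t => stk i o (Function.update (Function.update W w' ((l.take t).reverse ++ W w')) w
      (l.drop t))) ?_ ?_
  · refine Do.mono (b := l.length * (1 + 1) + 1) ?_ (by omega)
    unfold P5Coloring.move
    simpa [← hl] using h
  · intro t ht
    refine ⟨i, o, _, l[t], l.drop (t + 1), rfl, ?_, ?_⟩
    · simp
    · refine ⟨some l[t], ?_⟩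
      have h := Runs.pushW (i := i) (o := o)
        (W := Function.update (Function.update (Function.update W w'
          ((l.take t).reverse ++ W w')) w (l.drop t)) w (l.drop (t + 1))) w' a l[t]
      convert h using 2
      funext z
      by_cases h1 : z = w'
      · subst h1
        simp only [ne_eq, hw.symm, not_false_eq_true, Function.update_of_ne, Function.update_self,
          List.take_add_one, List.getElem?_eq_getElem ht, List.reverse_append]
        rfl
      · by_cases h2 : z = w
        · subst h2
          simp [h1]
        · simp [h1, h2]
  · simp [stk]

/-- Move the position in the matrix by one entry. -/
def shift : WProg C J := .seq (popW .mat) (pushW .aux)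

/-- With the given counters, the program moves the position in the matrix by `s` entries. -/
def Shifts (p : WProg C J) (s : ℕ) (lo hi tp : J → List (Sym C)) (b : ℕ) : Prop :=
  ∀ i o a l r x, l.length = s → Do p a (stk i o (mem (l ++ r) x lo hi tp)) a
    (stk i o (mem r (l.reverse ++ x) lo hi tp)) b

variable {lo hi tp : J → List (Sym C)}

theorem Shifts.shift : Shifts (shift : WProg C J) 1 lo hi tp 2 := by
  intro i o a l r x hl
  obtain ⟨s, rfl⟩ := List.length_eq_one_iff.1 hl
  intro r'
  have h1 := Runs.popW (i := i) (o := o) (W := mem (s :: r) x lo hi tp) (v := (a, r')) .mat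
  have h2 := Runs.pushW (i := i) (o := o) (W := mem r x lo hi tp) .aux a s
  rw [update_mem_mat] at h1
  rw [update_mem_aux] at h2
  exact ⟨_, h1.seq h2⟩

theorem Shifts.seq {s s' : ℕ} (hp : Shifts p s lo hi tp b) (hq : Shifts q s' lo hi tp b') :
    Shifts (.seq p q) (s + s') lo hi tp (b' + b) := by
  intro i o a l r x hl
  have h1 := hp i o a (l.take s) (l.drop s ++ r) x (by simp [hl])
  have h2 := hq i o a (l.drop s) r ((l.take s).reverse ++ x) (by simp [hl])
  rw [← List.append_assoc, List.take_append_drop] at h1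
  rw [← List.append_assoc, ← List.reverse_append, List.take_append_drop] at h2
  exact h1.seq h2

/-- Run `p` as often as the number attached to `j` says. -/
def times (j : J) (p : WProg C J) : WProg C J :=
  .seq (each (.lo j) (.seq (pushW (.tp j)) p)) (move (.tp j) (.lo j))

/-- The number attached to `j` is restored after the repetitions, and `p` may use all counters but
that of `j`. -/
theorem Shifts.times {j : J} {c s n : ℕ} (hlo : lo j = rep c) (htp : tp j = []) (hc : c ≤ n)
    (hp : ∀ t < c, Shifts p s (Function.update lo j (rep (c - (t + 1)))) hi
      (Function.update tp j (rep (t + 1))) b) :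
    Shifts (times j p) (c * s) lo hi tp (n * (b + 4) + 2) := by
  intro i o a l r x hl
  have h := Do.each (p := .seq (pushW (.tp j)) p) (w := .lo j) (N := c) (b := b + 1) (fun _ => a)
    (fun t => stk i o (mem (l.drop (t * s) ++ r) ((l.take (t * s)).reverse ++ x)
      (Function.update lo j (rep (c - t))) hi (Function.update tp j (rep t)))) ?_ (by
        simp [stk, mem])
  · have h2 := Do.move (a := a) (i := i) (o := o) (w := .tp j) (w' := .lo j) (n := n)
      (W := mem r (l.reverse ++ x) (Function.update lo j []) hi (Function.update tp j (rep c)))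
      (by simp) (by simpa [mem] using hc)
    rw [update_mem_lo, update_mem_tp] at h2
    have e1 : l.drop (c * s) = [] := by simp [← hl]
    have e2 : l.take (c * s) = l := by simp [← hl]
    have e3 : Function.update lo j (rep c) = lo := by rw [← hlo, Function.update_eq_self]
    have e4 : Function.update tp j [] = tp := by rw [← htp, Function.update_eq_self]
    simp only [mem, Function.update_self, Function.update_idem, List.reverse_replicate,
      List.append_nil, e3, e4] at h2
    simp only [e1, e2, Nat.sub_self, Nat.sub_zero, zero_mul, List.drop_zero, List.take_zero,
      List.reverse_nil, List.nil_append, e3, List.replicate_zero, e4] at h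
    refine (h.seq h2).mono ?_
    have := Nat.mul_le_mul_right (b + 2) hc
    nlinarith
  · intro t ht
    refine ⟨i, o, _, tok, rep (c - (t + 1)), rfl, ?_, ?_⟩
    · obtain ⟨k, rfl⟩ : ∃ k, c = t + 1 + k := ⟨c - (t + 1), by omega⟩
      simp only [mem, Function.update_self, show t + 1 + k - t = k + 1 by omega,
        show t + 1 + k - (t + 1) = k by omega, List.replicate_succ]
    · have h1 := Runs.pushW (i := i) (o := o) (W := Function.update (mem (l.drop (t * s) ++ r)
        ((l.take (t * s)).reverse ++ x) (Function.update lo j (rep (c - t))) hi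
        (Function.update tp j (rep t))) (.lo j) (rep (c - (t + 1)))) (.tp j) a tok
      obtain ⟨r', h2⟩ := hp t ht i o a ((l.drop (t * s)).take s) (l.drop ((t + 1) * s) ++ r)
        ((l.take (t * s)).reverse ++ x) (by
          have : (t + 1) * s ≤ l.length := hl ▸ Nat.mul_le_mul_right s ht
          rw [Nat.succ_mul] at this
          simp only [List.length_take, List.length_drop]
          omega) (some tok)
      rw [update_mem_lo, update_mem_tp] at h1
      simp only [mem, Function.update_self, Function.update_idem] at h1
      have e1 : (l.drop (t * s)).take s ++ (l.drop ((t + 1) * s) ++ r) = l.drop (t * s) ++ r := by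
        rw [Nat.succ_mul, ← List.drop_drop, ← List.append_assoc, List.take_append_drop]
      have e2 : ((l.drop (t * s)).take s).reverse ++ ((l.take (t * s)).reverse ++ x) =
          (l.take ((t + 1) * s)).reverse ++ x := by
        rw [Nat.succ_mul, List.take_add, List.reverse_append, List.append_assoc]
      rw [e1, e2] at h2
      rw [update_mem_lo, Function.update_idem]
      exact ⟨r', h1.seq h2⟩

end Do

section Access

variable {C ι : Type} [DecidableEq ι]

/-- Go to the entry of the matrix in row `r` and column `c`, apply `f` to it and to the state, and
return to the start of the matrix. The counter `none` contains the number of vertices. -/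
def access (r : ι) (c : Option ι) (f : St C → St C) : WProg C (Option ι) :=
  .seq (.seq (times (some r) (.seq (times none shift) shift)) (times c shift))
    (.seq (.seq (popW .mat) (.seq (.load f) (pushW .mat))) (move .aux .mat))

/-- The entry in row `x` and column `y` has position `x * (n + 1) + y` in the matrix. -/
theorem Do.access {r : ι} {c : Option ι} {f : St C → St C} {n x y : ℕ} {i o} {a a' : Bool}
    {lo hi : Option ι → List (Sym C)} {l : List (Sym C)} (hn : lo none = rep n)
    (hx : lo (some r) = rep x) (hy : lo c = rep y) (hxn : x < n) (hyn : y ≤ n)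
    (hl : l.length = n * (n + 1)) {s s' : Sym C} (hs : l[x * (n + 1) + y]? = some s)
    (hf : f (a, some s) = (a', some s')) :
    Do (access r c f) a (stk i o (mem l [] lo hi fun _ => [])) a'
      (stk i o (mem (l.set (x * (n + 1) + y) s') [] lo hi fun _ => [])) (8 * (n + 1) ^ 2) := by
  have hrow : Shifts (.seq (times (some r) (.seq (times none shift) shift)) (times c shift) :
      WProg C (Option ι)) (x * (n * 1 + 1) + y * 1) lo hi (fun _ => [])
      ((n * (2 + 4) + 2) + (n * ((2 + (n * (2 + 4) + 2)) + 4) + 2)) := by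
    refine .seq (.times hx rfl hxn.le fun t _ => .seq (.times ?_ ?_ le_rfl fun _ _ => .shift)
      .shift) (.times hy rfl hyn fun _ _ => .shift)
    · rw [Function.update_of_ne (by simp), hn]
    · rw [Function.update_of_ne (by simp)]
  obtain ⟨hp, hs⟩ := List.getElem?_eq_some_iff.1 hs
  rw [mul_one, mul_one] at hrow
  generalize x * (n + 1) + y = p at *
  have h1 := hrow i o a (l.take p) (l.drop p) [] (by simp [hp.le])
  rw [List.take_append_drop, List.append_nil] at h1
  have h2 : Do (.seq (popW .mat) (.seq (.load f) (pushW .mat))) a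
      (stk i o (mem (l.drop p) (l.take p).reverse lo hi fun _ => [])) a'
      (stk i o (mem (s' :: l.drop (p + 1)) (l.take p).reverse lo hi fun _ => [])) 3 := by
    intro r'
    have h3 := Runs.popW (i := i) (o := o) (v := (a, r'))
      (W := mem (l.drop p) (l.take p).reverse lo hi fun _ => []) .mat
    have h4 := Runs.pushW (i := i) (o := o)
      (W := mem (l.drop (p + 1)) (l.take p).reverse lo hi fun _ => []) .mat a' s'
    rw [update_mem_mat] at h3 h4
    simp only [mem, List.head?_drop, List.getElem?_eq_getElem hp, hs, List.tail_drop] at h3 h4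
    refine ⟨some s', h3.seq (Runs.seq ⟨1, le_rfl, .load _ _ _⟩ ?_)⟩
    rw [hf]
    exact h4
  have h5 := Do.move (a := a') (i := i) (o := o) (w := .aux) (w' := .mat) (n := n * (n + 1))
    (W := mem (s' :: l.drop (p + 1)) (l.take p).reverse lo hi fun _ => []) (by simp) (by
      simp only [mem, List.length_reverse, List.length_take]
      omega)
  rw [update_mem_mat, update_mem_aux] at h5
  simp only [mem, List.reverse_reverse] at h5
  rw [List.set_eq_take_append_cons_drop, if_pos hp]
  refine (h1.seq (h2.seq h5)).mono ?_
  nlinarith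

end Access

end P5Coloring

/-! ### Evaluation of first-order formulas -/

namespace P5Coloring

section Eval

variable {C : Type}

open Classical in
/-- The entries of the matrix of an instance: the adjacency matrix, and the colours of the vertices
in one more column. -/
noncomputable def Inst.entry (I : Inst C) (x y : ℕ) : Sym C :=
  if hx : x < I.n then
    if hy : y < I.n then Sum.inl (decide (I.graph.Adj ⟨x, hx⟩ ⟨y, hy⟩)) else Sum.inr (I.col ⟨x, hx⟩)
  else Sum.inr none

open Classical in
theorem Inst.entry_of_lt (I : Inst C) {x y : ℕ} (hx : x < I.n) (hy : y < I.n) :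
    I.entry x y = Sum.inl (decide (I.graph.Adj ⟨x, hx⟩ ⟨y, hy⟩)) := by
  rw [Inst.entry, dif_pos hx, dif_pos hy]

theorem Inst.entry_last (I : Inst C) {x : ℕ} (hx : x < I.n) :
    I.entry x I.n = Sum.inr (I.col ⟨x, hx⟩) := by
  rw [Inst.entry, dif_pos hx, dif_neg (lt_irrefl _)]

/-- The matrix of an instance, row by row. -/
noncomputable def Inst.matrix (I : Inst C) : List (Sym C) :=
  (List.range (I.n * (I.n + 1))).map fun p => I.entry (p / (I.n + 1)) (p % (I.n + 1))

theorem Inst.length_matrix (I : Inst C) : I.matrix.length = I.n * (I.n + 1) := by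
  simp [Inst.matrix]

theorem position_lt {n x y : ℕ} (hx : x < n) (hy : y ≤ n) : x * (n + 1) + y < n * (n + 1) := by
  nlinarith

theorem Inst.getElem?_matrix (I : Inst C) {x y : ℕ} (hx : x < I.n) (hy : y ≤ I.n) :
    I.matrix[x * (I.n + 1) + y]? = some (I.entry x y) := by
  have h1 : (x * (I.n + 1) + y) / (I.n + 1) = x := by
    rw [mul_comm, Nat.mul_add_div (by omega), Nat.div_eq_of_lt (by omega), add_zero]
  have h2 : (x * (I.n + 1) + y) % (I.n + 1) = y := by
    rw [mul_comm, Nat.mul_add_mod, Nat.mod_eq_of_lt (by omega)]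
  simp [Inst.matrix, position_lt hx hy, h1, h2]

/-- Give the vertex `v` the colour `c`. -/
def Inst.set (I : Inst C) (v : Fin I.n) (c : C) : Inst C where
  n := I.n
  graph := I.graph
  col := Function.update I.col v (some c)

theorem Inst.matrix_set (I : Inst C) (v : Fin I.n) (c : C) :
    (I.set v c).matrix = I.matrix.set (v * (I.n + 1) + I.n) (Sum.inr (some c)) := by
  apply List.ext_getElem?
  intro p
  by_cases hp : p < I.n * (I.n + 1)
  · have hx : p / (I.n + 1) < I.n := Nat.div_lt_of_lt_mul (by rwa [mul_comm])
    have hy : p % (I.n + 1) ≤ I.n := Nat.le_of_lt_succ (Nat.mod_lt _ (by omega))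
    obtain ⟨x, y, hx', hy', rfl⟩ : ∃ x y, x < I.n ∧ y ≤ I.n ∧ p = x * (I.n + 1) + y :=
      ⟨_, _, hx, hy, by rw [mul_comm, Nat.div_add_mod]⟩
    have hset : (I.set v c).matrix[x * (I.n + 1) + y]? = some ((I.set v c).entry x y) :=
      (I.set v c).getElem?_matrix hx' hy'
    rw [List.getElem?_set, hset, length_matrix, I.getElem?_matrix hx' hy',
      if_pos (position_lt v.2 le_rfl)]
    split_ifs with h
    · have hxy : x = v ∧ y = I.n := by
        rcases lt_trichotomy x v with hlt | rfl | hlt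
        · nlinarith
        · exact ⟨rfl, by omega⟩
        · nlinarith
      obtain ⟨rfl, rfl⟩ := hxy
      simp [Inst.entry, Inst.set]
    · congr 1
      obtain hyn | rfl := hy'.lt_or_eq
      · exact ((I.set v c).entry_of_lt hx' hyn).trans (I.entry_of_lt hx' hyn).symm
      · refine ((I.set v c).entry_last hx').trans (Eq.trans ?_ (I.entry_last hx').symm)
        refine congrArg Sum.inr (Function.update_of_ne (fun he => ?_) _ _)
        exact h (by rw [← he])
  · rw [List.getElem?_eq_none, List.getElem?_eq_none]
    · rw [List.length_set, I.length_matrix]; omega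
    · rw [Inst.length_matrix]; exact Nat.le_of_not_lt hp

variable {J : Type} [DecidableEq J]

/-- The work stacks with the matrix of an instance and the given counters. -/
noncomputable def cmem (I : Inst C) (x h : J → ℕ) : Work J → List (Sym C) :=
  mem I.matrix [] (fun j => rep (x j)) (fun j => rep (h j)) fun _ => []

theorem update_cmem_lo (I : Inst C) (x h : J → ℕ) (j : J) (t : ℕ) :
    Function.update (cmem I x h) (.lo j) (rep t) = cmem I (Function.update x j t) h := by
  rw [cmem, update_mem_lo]
  exact congrArg (fun f => mem _ _ f _ _) (Function.comp_update (fun n => rep n) x j t).symm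

theorem update_cmem_hi (I : Inst C) (x h : J → ℕ) (j : J) (t : ℕ) :
    Function.update (cmem I x h) (.hi j) (rep t) = cmem I x (Function.update h j t) := by
  rw [cmem, update_mem_hi]
  exact congrArg (fun f => mem _ _ _ f _) (Function.comp_update (fun n => rep n) h j t).symm

variable {ι : Type} [DecidableEq ι]

theorem Do.read {I : Inst C} {x h : Option ι → ℕ} (hn : x none = I.n) {r : ι} {c : Option ι}
    (hr : x (some r) < I.n) (hc : x c ≤ I.n) (g : Option (Sym C) → Bool) (a : Bool) (i o) :
    Do (P5Coloring.access r c fun v => (g v.2, v.2)) a (stk i o (cmem I x h))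
      (g (some (I.entry (x (some r)) (x c)))) (stk i o (cmem I x h)) (8 * (I.n + 1) ^ 2) := by
  have hs := I.getElem?_matrix hr hc
  have h1 := Do.access (i := i) (o := o) (lo := fun j => rep (x j)) (hi := fun j => rep (h j))
    (a := a) (f := fun v => (g v.2, v.2)) (r := r) (c := c) (congrArg _ hn) rfl rfl hr hc
    I.length_matrix hs rfl
  obtain ⟨hp, hs⟩ := List.getElem?_eq_some_iff.1 hs
  rwa [← hs, List.set_getElem_self, hs] at h1

theorem Do.write {I : Inst C} {x h : Option ι → ℕ} (hn : x none = I.n) {r : ι} (v : Fin I.n)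
    (hr : x (some r) = v) (c : C) (a : Bool) (i o) :
    Do (P5Coloring.access r none fun v => (v.1, some (Sum.inr (some c)))) a (stk i o (cmem I x h)) a
      (stk i o (cmem (I.set v c) x h)) (8 * (I.n + 1) ^ 2) := by
  have h1 := Do.access (i := i) (o := o) (lo := fun j => rep (x j)) (hi := fun j => rep (h j))
    (a := a) (f := fun v => (v.1, some (Sum.inr (some c)))) (r := r) (c := none)
    (congrArg _ hn) (congrArg _ hr) (congrArg _ hn) v.2 le_rfl
    I.length_matrix (I.getElem?_matrix v.2 le_rfl) rfl
  rwa [← Inst.matrix_set] at h1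

open Classical in
/-- The program decides whether the relation `P` holds for the vertices that are the values of the
first `m` counters, given that the other counters have not been used so far. -/
def Decides {B m : ℕ} (p : WProg C (Option (Fin B))) (hB : m ≤ B)
    (P : (I : Inst C) → (Fin m → Fin I.n) → Prop) (b : ℕ → ℕ) : Prop :=
  ∀ (I : Inst C) (e : Fin m → Fin I.n) (x h : Option (Fin B) → ℕ), x none = I.n →
    (∀ t : Fin m, x (some (t.castLE hB)) = e t) →
    (∀ t : Fin B, m ≤ t → x (some t) = 0 ∧ h (some t) = I.n) →
    ∀ a i o, Do p a (stk i o (cmem I x h)) (decide (P I e)) (stk i o (cmem I x h)) (b I.n)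

/-- Search all values of the counter `j` for one for which `p` succeeds. -/
def search {B : ℕ} (j : Fin B) (p : WProg C (Option (Fin B))) : WProg C (Option (Fin B)) :=
  .seq (setFlag fun _ => false) (.seq
    (each (.hi (some j)) (.seq (.ite Prod.fst skip p) (pushTok (.lo (some j)))))
    (move (.lo (some j)) (.hi (some j))))

theorem Decides.search {B m : ℕ} {p : WProg C (Option (Fin B))} {hB : m + 1 ≤ B}
    {P : (I : Inst C) → (Fin m → Fin I.n) → Fin I.n → Prop} {b : ℕ → ℕ}
    (hp : Decides p hB (fun I e => P I (e ∘ Fin.castSucc) (e (Fin.last m))) b) :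
    Decides (search ⟨m, hB⟩ p) (Nat.le_of_succ_le hB) (fun I e => ∃ v, P I e v)
      fun n => n * (b n + 4) + 2 * n + 3 := by
  classical
  intro I e x h hn hx hfree a i o
  obtain ⟨hx0, hh0⟩ := hfree ⟨m, hB⟩ le_rfl
  let j : Option (Fin B) := some ⟨m, hB⟩
  have hloop := Do.each (p := .seq (.ite Prod.fst skip p) (pushTok (.lo j))) (w := .hi j)
    (N := I.n) (b := b I.n + 3) (fun t => decide (∃ v : Fin I.n, v.1 < t ∧ P I e v))
    (fun t => stk i o (cmem I (Function.update x j t) (Function.update h j (I.n - t)))) ?_ ?_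
  · have hmove := Do.move (a := decide (∃ v : Fin I.n, P I e v)) (i := i) (o := o) (w := .lo j)
      (w' := .hi j) (n := I.n) (W := cmem I (Function.update x j I.n) (Function.update h j 0))
      (by simp) (by simp [cmem, mem])
    have e1 : ((cmem (C := C) I (Function.update x j I.n)
        (Function.update h j 0)) (.lo j)).reverse ++
        (cmem I (Function.update x j I.n) (Function.update h j 0)) (.hi j) = rep I.n := by
      simp [cmem, mem]
    rw [e1, update_cmem_hi, show ([] : List (Sym C)) = rep 0 from rfl, update_cmem_lo,
      Function.update_idem, Function.update_idem] at hmove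
    have e2 : Function.update x j 0 = x := by rw [← hx0, Function.update_eq_self]
    have e3 : Function.update h j I.n = h := by rw [← hh0, Function.update_eq_self]
    rw [e2, e3] at hmove
    simp only [Nat.not_lt_zero, false_and, exists_false, decide_false, e2, Nat.sub_zero, e3,
      Fin.is_lt, true_and, Nat.sub_self] at hloop
    refine Do.mono (b := 2 * I.n + 1 + (I.n * (b I.n + 3 + 1) + 1) + 1) ?_ (by ring_nf; omega)
    convert (Do.setFlag (a := a) fun _ => false).seq (hloop.seq hmove)
    rfl
  · intro t ht
    refine ⟨i, o, _, tok, rep (I.n - (t + 1)), rfl, ?_, ?_⟩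
    · obtain ⟨k, hk⟩ : ∃ k, I.n - t = k + 1 := ⟨I.n - (t + 1), by omega⟩
      simp [cmem, mem, hk, List.replicate_succ, show I.n - (t + 1) = k by omega]
    · rw [update_cmem_hi, Function.update_idem]
      have hpush : Do (pushTok (.lo j)) (decide (∃ v : Fin I.n, v.1 < t + 1 ∧ P I e v))
          (stk i o (cmem I (Function.update x j t) (Function.update h j (I.n - (t + 1)))))
          (decide (∃ v : Fin I.n, v.1 < t + 1 ∧ P I e v))
          (stk i o (cmem I (Function.update x j (t + 1)) (Function.update h j (I.n - (t + 1)))))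
          1 := by
        have := Do.pushTok (a := decide (∃ v : Fin I.n, v.1 < t + 1 ∧ P I e v)) (i := i) (o := o)
          (W := cmem I (Function.update x j t) (Function.update h j (I.n - (t + 1)))) (.lo j)
        have e1 : tok :: (cmem I (Function.update x j t) (Function.update h j (I.n - (t + 1))))
            (.lo j) = (rep (t + 1) : List (Sym C)) := by simp [cmem, mem, List.replicate_succ]
        rwa [e1, update_cmem_lo, Function.update_idem] at this
      refine (Do.seq (b := b I.n + 2) ?_ hpush).mono (by omega) _
      by_cases hex : ∃ v : Fin I.n, v.1 < t ∧ P I e v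
      · have hex' : ∃ v : Fin I.n, v.1 < t + 1 ∧ P I e v :=
          hex.imp fun v hv => ⟨hv.1.trans (Nat.lt_succ_self t), hv.2⟩
        rw [decide_eq_true hex, decide_eq_true hex']
        exact Do.skip.ite_true.mono (by omega)
      · have hiff : (∃ v : Fin I.n, v.1 < t + 1 ∧ P I e v) ↔ P I e ⟨t, ht⟩ := by
          constructor
          · rintro ⟨v, hv, hP⟩
            obtain hlt | heq := Nat.lt_succ_iff_lt_or_eq.1 hv
            · exact absurd ⟨v, hlt, hP⟩ hex
            · rwa [show v = ⟨t, ht⟩ from Fin.ext heq] at hP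
          · exact fun hP => ⟨_, Nat.lt_succ_self t, hP⟩
        have hb := hp I (Fin.snoc e ⟨t, ht⟩) (Function.update x j t)
          (Function.update h j (I.n - (t + 1))) (by simpa [j] using hn) ?_ ?_ false i o
        · have hsnoc : (Fin.snoc e ⟨t, ht⟩ : Fin (m + 1) → Fin I.n) ∘ Fin.castSucc = e := by
            funext s
            simp
          simp only [hsnoc, Fin.snoc_last] at hb
          rw [decide_eq_false hex]
          simp only [hiff]
          exact hb.ite_false.mono (by omega)
        · intro s
          refine Fin.lastCases ?_ (fun s => ?_) s
          · rw [Fin.snoc_last]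
            exact Function.update_self ..
          · rw [Fin.snoc_castSucc, ← hx s]
            refine Function.update_of_ne ?_ _ _
            have := s.2
            simp [j, Fin.ext_iff]
            omega
        · intro s hs
          have hne : some s ≠ j := by
            simp [j, Fin.ext_iff]
            omega
          rw [Function.update_of_ne hne, Function.update_of_ne hne]
          exact hfree s (by omega)
  · simp [stk, cmem, mem]

/-- First-order relations can be decided in polynomial time. The number `d` bounds the counters that
the quantifiers of the formula need. -/
theorem FO.exists_decides {m : ℕ} {P : (I : Inst C) → (Fin m → Fin I.n) → Prop} (hP : FO m P) :
    ∃ d, ∀ B (hB : m ≤ B), m + d ≤ B → ∃ (p : WProg C (Option (Fin B))) (q : Polynomial ℕ),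
      Decides p hB P fun n => q.eval n := by
  classical
  induction hP with
  | const p =>
    exact ⟨0, fun B hB _ => ⟨setFlag fun _ => decide p, 1, fun I e x h _ _ _ a i o =>
      (Do.setFlag _).mono (by simp)⟩⟩
  | adj u v =>
    refine ⟨0, fun B hB _ => ⟨access (u.castLE hB) (some (v.castLE hB))
      fun v => (decide (v.2 = some (Sum.inl true)), v.2), 8 * (Polynomial.X + 1) ^ 2, ?_⟩⟩
    intro I e x h hn hx _ a i o
    have := Do.read (h := h) hn (r := u.castLE hB) (c := some (v.castLE hB)) (by simp [hx])
      (by simp [hx, (e v).2.le]) (fun s => decide (s = some (Sum.inl true))) a i o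
    rw [hx, hx] at this
    simpa [Inst.entry] using this
  | col u p =>
    refine ⟨0, fun B hB _ => ⟨access (u.castLE hB) none
      fun v => (decide (∃ c, v.2 = some (Sum.inr c) ∧ p c), v.2), 8 * (Polynomial.X + 1) ^ 2, ?_⟩⟩
    intro I e x h hn hx _ a i o
    have := Do.read (h := h) hn (r := u.castLE hB) (c := none) (by simp [hx]) hn.le
      (fun s => decide (∃ c, s = some (Sum.inr c) ∧ p c)) a i o
    rw [hx, hn] at this
    simpa [Inst.entry] using this
  | not _ ih =>
    obtain ⟨d, ih⟩ := ih
    refine ⟨d, fun B hB hd => ?_⟩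
    obtain ⟨p, q, hp⟩ := ih B hB hd
    refine ⟨.seq p (setFlag fun a => !a), 1 + q, fun I e x h hn hx hf a i o => ?_⟩
    have := (hp I e x h hn hx hf a i o).seq (Do.setFlag fun a => !a)
    simpa using this
  | @and m P Q _ _ ih₁ ih₂ =>
    obtain ⟨d₁, ih₁⟩ := ih₁
    obtain ⟨d₂, ih₂⟩ := ih₂
    refine ⟨d₁ + d₂, fun B hB hd => ?_⟩
    obtain ⟨p₁, q₁, hp₁⟩ := ih₁ B hB (by omega)
    obtain ⟨p₂, q₂, hp₂⟩ := ih₂ B hB (by omega)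
    refine ⟨.seq p₁ (.ite Prod.fst p₂ skip), q₂ + 2 + q₁, fun I e x h hn hx hf a i o => ?_⟩
    simp only [Polynomial.eval_add, Polynomial.eval_ofNat]
    refine (hp₁ I e x h hn hx hf a i o).seq ?_
    by_cases hPe : P I e
    · have := (hp₂ I e x h hn hx hf true i o).ite_true (q := skip)
      refine Do.mono (b := q₂.eval I.n + 1) ?_ (by omega)
      simpa [hPe] using this
    · simpa [hPe] using (Do.skip.ite_false (p := p₂)).mono (by omega)
  | @ex m P _ ih =>
    obtain ⟨d, ih⟩ := ih
    refine ⟨d + 1, fun B hB hd => ?_⟩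
    obtain ⟨p, q, hp⟩ := ih B (by omega) (by omega)
    refine ⟨search ⟨m, by omega⟩ p,
      Polynomial.X * (q + 4) + 2 * Polynomial.X + 3, ?_⟩
    simpa using hp.search

end Eval

end P5Coloring

/-! ### The colouring machine -/

namespace P5Coloring

section Color

variable {C : Type} {B : ℕ}

/-- Give the vertex in counter `r` the colours of a list one after another, until `p` succeeds. -/
def tryColors (r : Fin B) (p : WProg C (Option (Fin B))) : List C → WProg C (Option (Fin B))
  | [] => skip
  | c :: cs => .seq
    (.ite Prod.fst skip (.seq (access r none fun v => (v.1, some (Sum.inr (some c)))) p))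
    (tryColors r p cs)

theorem Do.tryColors_true (r : Fin B) (p : WProg C (Option (Fin B))) (cs : List C)
    (S : ∀ k, List (Alph C (Option (Fin B)) k)) :
    Do (tryColors r p cs) true S true S (2 * cs.length + 1) := by
  induction cs with
  | nil => exact Do.skip
  | cons c cs ih => exact (Do.skip.ite_true.seq ih).mono (by simp; omega)

theorem Decides.tryColors {p : WProg C (Option (Fin B))} {hB : 1 ≤ B}
    {P : (I : Inst C) → (Fin 1 → Fin I.n) → Prop} {b : ℕ → ℕ} (hp : Decides p hB P b)
    (hP : ∀ I e, P5Free I.graph → (P I e ↔ Extendable I)) (cs : List C) (I : Inst C)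
    (hG : P5Free I.graph) (v : Fin I.n) {x h : Option (Fin B) → ℕ} (hn : x none = I.n)
    (hv : x (some ⟨0, hB⟩) = v) (hfree : ∀ t : Fin B, 1 ≤ t.1 → x (some t) = 0 ∧ h (some t) = I.n)
    (hc : ∃ c ∈ cs, Extendable (I.set v c)) (i o) :
    ∃ c, Extendable (I.set v c) ∧ Do (tryColors ⟨0, hB⟩ p cs) false (stk i o (cmem I x h)) true
      (stk i o (cmem (I.set v c) x h)) (cs.length * (b I.n + 8 * (I.n + 1) ^ 2 + 2) + 1) := by
  classical
  induction cs generalizing I with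
  | nil => simp at hc
  | cons c cs ih =>
    have hw := Do.write hn v hv c false i o (h := h)
    have hd := hp (I.set v c) (fun _ => v) x h hn (fun t => by
      rw [Subsingleton.elim t 0]; exact hv) hfree false i o
    have hfirst := (hw.seq hd).ite_false (p := skip)
    have h8 : 1 ≤ (I.n + 1) ^ 2 := Nat.one_le_pow _ _ (by omega)
    by_cases hext : Extendable (I.set v c)
    · rw [decide_eq_true ((hP (I.set v c) (fun _ => v) hG).2 hext)] at hfirst
      refine ⟨c, hext, (hfirst.seq (Do.tryColors_true _ _ cs _)).mono ?_⟩
      simp only [List.length_cons, Inst.set]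
      nlinarith
    · rw [decide_eq_false (fun h => hext ((hP (I.set v c) (fun _ => v) hG).1 h))] at hfirst
      have hset : ∀ c', (I.set v c).set v c' = I.set v c' := fun c' => by
        exact congrArg (Inst.mk I.n I.graph) (Function.update_idem ..)
      obtain ⟨c', hc', hdo⟩ := ih (I.set v c) hG v hn hv hfree (by
        obtain ⟨c', hc', he⟩ := hc
        rcases List.mem_cons.1 hc' with rfl | hc'
        · exact absurd he hext
        · exact ⟨c', hc', (hset c').symm ▸ he⟩)
      rw [hset c'] at hc' hdo
      refine ⟨c', hc', (hfirst.seq hdo).mono ?_⟩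
      simp only [List.length_cons, Inst.set]
      nlinarith

/-- Colour all vertices, keeping the partial colouring extendable. -/
noncomputable def colorAll [Fintype C] (j : Fin B) (p : WProg C (Option (Fin B))) :
    WProg C (Option (Fin B)) :=
  each (.hi (some j)) (.seq (setFlag fun _ => false)
    (.seq (tryColors j p Finset.univ.toList) (pushTok (.lo (some j)))))

theorem Extendable.exists_set {I : Inst C} (h : Extendable I) (v : Fin I.n) :
    ∃ c, Extendable (I.set v c) := by
  obtain ⟨φ, h1, h2⟩ := h
  refine ⟨φ v, φ, fun w => ?_, h2⟩
  by_cases hw : w = v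
  · refine .inr (show Function.update I.col v (some (φ v)) w = some (φ w) from ?_)
    rw [hw, Function.update_self]
  · rw [show (I.set v (φ v)).col w = I.col w from Function.update_of_ne hw _ _]
    exact h1 w

/-- The instance of a graph without coloured vertices. -/
def Inst.ofGraph (C : Type) {n : ℕ} (G : SimpleGraph (Fin n)) : Inst C := ⟨n, G, fun _ => none⟩

theorem Decides.colorAll [Fintype C] {p : WProg C (Option (Fin B))} {hB : 1 ≤ B}
    {P : (I : Inst C) → (Fin 1 → Fin I.n) → Prop} {b : ℕ → ℕ} (hp : Decides p hB P b)
    (hP : ∀ I e, P5Free I.graph → (P I e ↔ Extendable I)) {n : ℕ} {G : SimpleGraph (Fin n)}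
    (hG : P5Free G) (hext : Extendable (Inst.ofGraph C G)) {x h : Option (Fin B) → ℕ}
    (hn : x none = n) (hfree : ∀ t : Fin B, x (some t) = 0 ∧ h (some t) = n) (i o) :
    ∃ φ : G.Coloring C, ∃ x' h' : Option (Fin B) → ℕ, (∀ j, x' j ≤ x j + n) ∧ (∀ j, h' j ≤ h j) ∧
      Do (colorAll ⟨0, hB⟩ p) true (stk i o (cmem (Inst.ofGraph C G) x h)) true
        (stk i o (cmem ⟨n, G, fun v => some (φ v)⟩ x' h'))
        (n * (Fintype.card C * (b n + 8 * (n + 1) ^ 2 + 2) + 4) + 1) := by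
  classical
  let j : Option (Fin B) := some ⟨0, hB⟩
  have hx0 : Function.update x j 0 = x := by rw [← (hfree ⟨0, hB⟩).1, Function.update_eq_self]
  have hh0 : Function.update h j n = h := by rw [← (hfree ⟨0, hB⟩).2, Function.update_eq_self]
  have hloop := Do.exists_each (w := .hi j) (a := true)
    (S := stk i o (cmem (Inst.ofGraph C G) x h))
    (p := .seq (setFlag fun _ => false)
      (.seq (P5Coloring.tryColors ⟨0, hB⟩ p Finset.univ.toList) (pushTok (.lo j))))
    (b := Fintype.card C * (b n + 8 * (n + 1) ^ 2 + 2) + 3) (N := n)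
    -- before iteration `t`, the vertices smaller than `t` have a colour and `t` is the value of the
    -- counter
    (fun t a S => a = true ∧ ∃ f : Fin n → Option C, Extendable ⟨n, G, f⟩ ∧
      (∀ v, v.1 < t → f v ≠ none) ∧ (∀ v, t ≤ v.1 → f v = none) ∧
      S = stk i o (cmem ⟨n, G, f⟩ (Function.update x j t) (Function.update h j (n - t)))) ?_ ?_ ?_
  · obtain ⟨a', S', ⟨rfl, f, hf, hf1, hf2, rfl⟩, hdo⟩ := hloop
    -- all vertices are coloured now, and the extension is the colouring itself
    obtain ⟨φ, h1, h2⟩ : ∃ φ : Fin n → C, (∀ v, f v = none ∨ f v = some (φ v)) ∧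
      ∀ u v, G.Adj u v → φ u ≠ φ v := hf
    have hfφ : f = fun v => some (φ v) := by
      funext v
      exact (h1 v).resolve_left (hf1 v v.2)
    subst hfφ
    refine ⟨SimpleGraph.Coloring.mk φ fun {u v} huv => h2 u v huv, _, _, fun s => ?_, fun s => ?_,
      hdo⟩
    · rw [Function.update_apply]
      split_ifs <;> omega
    · rw [Function.update_apply]
      split_ifs <;> omega
  · rintro t ht _ _ ⟨rfl, f, hf, hf1, hf2, rfl⟩
    refine ⟨i, o, _, tok, rep (n - (t + 1)), rfl, ?_, ?_⟩
    · obtain ⟨k, hk⟩ : ∃ k, n - t = k + 1 := ⟨n - (t + 1), by omega⟩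
      simp [cmem, mem, hk, List.replicate_succ, show n - (t + 1) = k by omega]
    · rw [update_cmem_hi, Function.update_idem]
      obtain ⟨c, hc⟩ := hf.exists_set ⟨t, ht⟩
      obtain ⟨c, hc, htry⟩ := hp.tryColors hP Finset.univ.toList ⟨n, G, f⟩ hG ⟨t, ht⟩
        (x := Function.update x j t) (h := Function.update h j (n - (t + 1)))
        (by simpa [j] using hn) (Function.update_self ..) (fun s hs => by
          have hne : some s ≠ j := by
            simp [j, Fin.ext_iff]
            omega
          rw [Function.update_of_ne hne, Function.update_of_ne hne]
          exact hfree s) ⟨c, by simp, hc⟩ i o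
      have hpush := Do.pushTok (a := true) (i := i) (o := o)
        (W := cmem (Inst.set ⟨n, G, f⟩ ⟨t, ht⟩ c) (Function.update x j t)
          (Function.update h j (n - (t + 1)))) (.lo j)
      have e1 : tok :: (cmem (Inst.set ⟨n, G, f⟩ ⟨t, ht⟩ c) (Function.update x j t)
          (Function.update h j (n - (t + 1)))) (.lo j) = rep (t + 1) := by
        simp [cmem, mem, List.replicate_succ]
      rw [e1, update_cmem_lo, Function.update_idem] at hpush
      obtain ⟨r', hrun⟩ := ((Do.setFlag (a := true) fun _ => false).seq (htry.seq hpush))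
        (some tok)
      refine ⟨true, r', _, ⟨rfl, Function.update f ⟨t, ht⟩ (some c), hc, fun v hv => ?_,
        fun v hv => ?_, rfl⟩, hrun.mono ?_⟩
      · by_cases hvt : v = ⟨t, ht⟩
        · subst hvt
          simp
        · rw [Function.update_of_ne hvt]
          have hne : v.1 ≠ t := fun he => hvt (Fin.ext he)
          exact hf1 v (by omega)
      · rw [Function.update_of_ne (by rintro rfl; simp at hv)]
        exact hf2 v (by omega)
      · simp
        omega
  · rintro _ _ ⟨-, f, -, -, -, rfl⟩
    simp [stk, cmem, mem]
  · exact ⟨rfl, fun _ => none, hext, by simp, by simp, by rw [hx0, Nat.sub_zero, hh0]; rfl⟩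

end Color

section InOut

variable {C : Type}

theorem map_range_mul {α : Type} (n m : ℕ) (hm : 0 < m) (g : ℕ → ℕ → α) :
    (List.range (n * m)).map (fun p => g (p / m) (p % m)) =
      (List.range n).flatMap fun x => (List.range m).map (g x) := by
  induction n with
  | zero => simp
  | succ n ih =>
    rw [Nat.succ_mul, List.range_add, List.map_append, ih, List.range_succ, List.flatMap_append,
      List.map_map, List.flatMap_singleton]
    congr 1
    refine List.map_congr_left fun y hy => ?_
    have hy := List.mem_range.1 hy
    simp only [Function.comp]
    rw [mul_comm n m, Nat.mul_add_div hm, Nat.div_eq_of_lt hy, add_zero, Nat.mul_add_mod,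
      Nat.mod_eq_of_lt hy]

open Classical in
theorem Inst.matrix_eq_flatMap (I : Inst C) :
    I.matrix = (List.finRange I.n).flatMap fun u =>
      ((List.finRange I.n).map fun v => Sum.inl (decide (I.graph.Adj u v))) ++
        [Sum.inr (I.col u)] := by
  rw [Inst.matrix, map_range_mul _ _ (by omega),
    ← List.map_coe_finRange_eq_range (n := I.n),
    List.flatMap_map]
  congr 1
  funext u
  rw [List.range_succ, List.map_append, ← List.map_coe_finRange_eq_range, List.map_map]
  congr 1
  · refine List.map_congr_left fun v _ => ?_
    exact I.entry_of_lt u.2 v.2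
  · simp [I.entry_last u.2]

/-- The matrix entry that a symbol of the input stands for. The commas at the ends of the rows
become the entries for the colours. -/
def decodeSym (C : Type) : Computability.Γ' → Sym C
  | .bit b => Sum.inl b
  | .comma => Sum.inr none
  | _ => Sum.inl false

theorem map_decodeSym_encode (G : P5FreeGraph) :
    G.encode.map (decodeSym C) = (Inst.ofGraph C G.graph).matrix := by
  rw [Inst.matrix_eq_flatMap, P5FreeGraph.encode, List.map_flatMap]
  congr 1
  funext u
  simp only [List.map_append, List.map_map, List.map_cons, List.map_nil, Inst.ofGraph]
  rfl

theorem count_comma_encode (G : P5FreeGraph) :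
    G.encode.count Computability.Γ'.comma = G.n := by
  have h : ∀ (l : List (Fin G.n)) (f : Fin G.n → Fin G.n → Bool),
      (l.flatMap fun u => ((List.finRange G.n).map fun v => Computability.Γ'.bit (f u v)) ++
        [Computability.Γ'.comma]).count Computability.Γ'.comma = l.length := by
    intro l f
    induction l with
    | nil => rfl
    | cons u l ih =>
      rw [List.flatMap_cons, List.count_append, ih, List.count_append, List.count_eq_zero.2]
      · simp [add_comm]
      · simp
  rw [P5FreeGraph.encode, h, List.length_finRange]

theorem length_encode (G : P5FreeGraph) : G.encode.length = G.n * (G.n + 1) := by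
  rw [← List.length_map (decodeSym Unit), map_decodeSym_encode, Inst.length_matrix]
  rfl

variable {J : Type} [DecidableEq J]

/-- Push a token onto each of the given stacks. -/
def pushToks : List (Work J) → WProg C J
  | [] => skip
  | w :: ws => .seq (pushTok w) (pushToks ws)

theorem Do.pushToks {ws : List (Work J)} (hws : ws.Nodup) (a : Bool) (i o)
    (W : Work J → List (Sym C)) : Do (pushToks ws) a (stk i o W) a
      (stk i o fun w => if w ∈ ws then tok :: W w else W w) (ws.length + 1) := by
  induction ws generalizing W with
  | nil => exact Do.skip.mono (by simp)
  | cons w ws ih =>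
    obtain ⟨h1, h2⟩ := List.nodup_cons.1 hws
    have := (Do.pushTok (i := i) (o := o) (a := a) (W := W) w).seq (ih h2 _)
    refine this.congr fun z => ?_
    by_cases hz : z = w
    · subst hz
      simp [h1]
    · simp [hz]

/-- Empty the given stacks. -/
def clearAll : List (Work J) → WProg C J
  | [] => skip
  | w :: ws => .seq (each w skip) (clearAll ws)

theorem Do.clearAll (ws : List (Work J)) (a : Bool) (i o) {N : ℕ} (W : Work J → List (Sym C))
    (hW : ∀ w, (W w).length ≤ N) : Do (clearAll ws) a (stk i o W) a
      (stk i o fun w => if w ∈ ws then [] else W w) (ws.length * (2 * N + 1) + 1) := by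
  induction ws generalizing W with
  | nil => exact Do.skip.mono (by simp)
  | cons w ws ih =>
    have h1 := Do.each (p := (P5Coloring.skip : WProg C J)) (w := w) (N := (W w).length)
      (b := 1) (fun _ => a)
      (fun t => stk i o (Function.update W w ((W w).drop t))) (by
        intro t ht
        refine ⟨i, o, _, (W w)[t], (W w).drop (t + 1), rfl, by simp, ?_⟩
        rw [Function.update_idem]
        exact Do.skip _) (by simp [stk])
    rw [List.drop_zero, Function.update_eq_self, List.drop_length] at h1
    have h2 := ih (Function.update W w []) fun z => by
      by_cases hz : z = w
      · subst hz
        simp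
      · simpa [hz] using hW z
    have h3 := (h1.seq h2).mono (b' := (ws.length + 1) * (2 * N + 1) + 1) (by
      have := hW w
      have : (ws.length + 1) * (2 * N + 1) = ws.length * (2 * N + 1) + (2 * N + 1) := by ring
      omega)
    refine h3.congr fun z => ?_
    by_cases hz : z = w
    · subst hz
      simp
    · simp [hz]

/-- The symbol of the output for an entry of the matrix that is a colour. -/
def encodeSym : Sym C → Option (Bool ⊕ C)
  | Sum.inr (some c) => some (Sum.inr c)
  | _ => none

/-- Write the colours in the matrix to the output. -/
def emitColors : WProg C J :=
  .seq (move .mat .aux) (each .aux (.ite (fun v => (v.2.bind encodeSym).isSome)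
    (.push .out fun v => (v.2.bind encodeSym).getD (Sum.inl false)) skip))

theorem Do.emitColors (a : Bool) (i o) (m : List (Sym C)) (lo hi tp : J → List (Sym C)) :
    Do (emitColors : WProg C J) a (stk i o (mem m [] lo hi tp)) a
      (stk i (m.filterMap encodeSym ++ o) (mem [] [] lo hi tp)) (5 * m.length + 2) := by
  have h1 := Do.move (a := a) (i := i) (o := o) (w := .mat) (w' := .aux) (n := m.length)
    (W := mem m [] lo hi tp) (by simp) le_rfl
  rw [update_mem_aux, update_mem_mat] at h1
  simp only [mem, List.append_nil] at h1
  generalize hl : m.reverse = l at h1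
  obtain rfl : m = l.reverse := by rw [← hl, List.reverse_reverse]
  have h2 := Do.each (p := (.ite (fun v => (v.2.bind encodeSym).isSome)
      (.push .out fun v => (v.2.bind encodeSym).getD (Sum.inl false)) P5Coloring.skip : WProg C J))
    (w := .aux) (N := l.length) (b := 2) (fun _ => a)
    (fun t => stk i ((l.take t).reverse.filterMap encodeSym ++ o) (mem [] (l.drop t) lo hi tp))
    ?_ (by simp [stk, mem])
  · simp only [List.take_zero, List.reverse_nil, List.filterMap_nil, List.nil_append,
      List.drop_zero, List.take_length, List.drop_length] at h2
    refine (h1.seq h2).mono ?_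
    simp only [List.length_reverse]
    omega
  · intro t ht
    refine ⟨i, _, _, l[t], l.drop (t + 1), rfl, by simp [mem], some l[t], ?_⟩
    rw [update_mem_aux]
    have e : (l.take (t + 1)).reverse = l[t] :: (l.take t).reverse := by
      rw [List.take_add_one, List.getElem?_eq_getElem ht, List.reverse_append]
      rfl
    rw [e]
    cases hs : encodeSym l[t] with
    | none =>
      rw [List.filterMap_cons_none hs]
      exact ⟨2, le_rfl, .ite_false (by simp [hs]) (.load _ _ _)⟩
    | some s =>
      rw [List.filterMap_cons_some hs, List.cons_append,
        ← update_stk_out i ((l.take t).reverse.filterMap encodeSym ++ o) _ (s :: _)]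
      refine ⟨2, le_rfl, .ite_true (by simp [hs]) ?_⟩
      have := Exec.push (Γ := Alph C J) (σ := St C) .out
        (fun v => (v.2.bind encodeSym).getD (Sum.inl false)) (a, some l[t])
        (stk i ((l.take t).reverse.filterMap encodeSym ++ o) (mem [] (l.drop (t + 1)) lo hi tp))
      simpa [hs, stk] using this

theorem filterMap_encodeSym_matrix {n : ℕ} (G : SimpleGraph (Fin n)) (φ : Fin n → C) :
    (Inst.matrix ⟨n, G, fun v => some (φ v)⟩).filterMap encodeSym =
      (List.finRange n).map fun v => Sum.inr (φ v) := by
  rw [Inst.matrix_eq_flatMap, List.filterMap_flatMap]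
  simp only [List.filterMap_append, List.filterMap_map]
  have : ∀ (l : List (Fin n)) (f : Fin n → Bool),
      l.filterMap ((encodeSym : Sym C → _) ∘ fun v => Sum.inl (f v)) = [] := fun l f => by
    rw [List.filterMap_eq_nil_iff]
    intro v _
    rfl
  simp only [this, List.nil_append]
  rw [List.map_eq_flatMap]
  rfl

variable {B : ℕ}

/-- The counters after `q` rows have been read. -/
def loCount (q : ℕ) : Option (Fin B) → ℕ
  | none => q
  | some _ => 0

/-- The remaining values of the counters after `q` rows have been read. -/
def hiCount (q : ℕ) : Option (Fin B) → ℕ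
  | none => 0
  | some _ => q

/-- The stacks of tokens of which there are as many as vertices. -/
noncomputable def counterStacks (B : ℕ) : List (Work (Option (Fin B))) :=
  .lo none :: (Finset.univ : Finset (Fin B)).toList.map fun t => .hi (some t)

/-- Copy the input to the work stacks, and set up the counters. -/
noncomputable def loadInput (C : Type) (B : ℕ) : WProg C (Option (Fin B)) :=
  open Classical in
  .loop .inp (fun v s => (v.1, s.map (decodeSym C))) (fun v => v.2.isSome)
    (.seq (pushW .aux) (.ite (fun v => decide (v.2 = some (Sum.inr none)))
      (pushToks (counterStacks B)) skip))

/-- Every comma of the input word `u` adds one to the number of rows `q` that have been read. -/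
theorem Do.loadInput (a : Bool) (u : List Computability.Γ') (o) (x : List (Sym C)) (q : ℕ) :
    Do (loadInput C B) a
      (stk u o (mem [] x (fun j => rep (loCount q j)) (fun j => rep (hiCount q j)) fun _ => [])) a
      (stk [] o (mem [] ((u.map (decodeSym C)).reverse ++ x)
        (fun j => rep (loCount (q + u.count Computability.Γ'.comma) j))
        (fun j => rep (hiCount (q + u.count Computability.Γ'.comma) j)) fun _ => []))
      (u.length * (B + 5) + 1) := by
  classical
  induction u generalizing x q with
  | nil =>
    intro r
    refine ⟨none, 1, by simp, ?_⟩
    have h := Exec.loop_done (Γ := Alph C (Option (Fin B))) (k := .inp)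
      (f := fun (v : St C) s => (v.1, s.map (decodeSym C))) (b := fun v => v.2.isSome)
      (p := .seq (pushW .aux) (.ite (fun v => decide (v.2 = some (Sum.inr none)))
        (P5Coloring.pushToks (counterStacks B)) P5Coloring.skip)) (v := (a, r))
      (S := stk [] o (mem [] x (fun j => rep (loCount q j)) (fun j => rep (hiCount q j))
        fun _ => []))
      rfl
    rw [show (stk [] o (mem (C := C) [] x (fun j => rep (loCount (B := B) q j))
      (fun j => rep (hiCount q j)) fun _ => []) .inp) = [] from rfl, List.tail_nil,
      update_stk_inp] at h
    exact h
  | cons s u ih =>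
    intro r
    have hbody : ∃ r', Runs (.seq (pushW .aux) (.ite (fun v => decide (v.2 = some (Sum.inr none)))
        (P5Coloring.pushToks (counterStacks B)) P5Coloring.skip) : WProg C (Option (Fin B)))
        (a, some (decodeSym C s)) (stk u o (mem [] x (fun j => rep (loCount q j))
          (fun j => rep (hiCount q j)) fun _ => [])) (a, r')
        (stk u o (mem [] (decodeSym C s :: x)
          (fun j => rep (loCount (q + [s].count Computability.Γ'.comma) j))
          (fun j => rep (hiCount (q + [s].count Computability.Γ'.comma) j)) fun _ => []))
        (B + 4) := by
      have h1 := Runs.pushW (i := u) (o := o) (W := mem [] x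
        (fun j : Option (Fin B) => rep (loCount q j)) (fun j => rep (hiCount q j)) fun _ => [])
        .aux a (decodeSym C s)
      rw [update_mem_aux] at h1
      by_cases hs : s = .comma
      · subst hs
        have hnd : (counterStacks B).Nodup := by
          refine List.nodup_cons.2 ⟨by simp, List.Nodup.map ?_ (Finset.nodup_toList _)⟩
          intro t t' h
          simpa using h
        have hdo := (Do.pushToks hnd a u o (mem [] (decodeSym C .comma :: x)
          (fun j => rep (loCount q j)) (fun j => rep (hiCount q j)) fun _ => [])).congr
          (W' := mem [] (decodeSym C .comma :: x) (fun j => rep (loCount (q + 1) j))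
            (fun j => rep (hiCount (q + 1) j)) fun _ => []) ?_
        · obtain ⟨r', t, ht, he⟩ := hdo (some (decodeSym C .comma))
          exact ⟨r', (h1.seq ⟨t + 1, Nat.succ_le_succ ht, .ite_true (by simp [decodeSym]) he⟩).mono
            (by simp [counterStacks])⟩
        intro w
        rcases w with _ | _ | (_ | t) | (_ | t) | t <;>
          simp [counterStacks, mem, loCount, hiCount, List.replicate_succ]
      · have hne : decodeSym C s ≠ Sum.inr none := by
          cases s <;> simp_all [decodeSym]
        have h2 := (h1.seq (q := .ite (fun v => decide (v.2 = some (Sum.inr none)))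
          (P5Coloring.pushToks (counterStacks B)) P5Coloring.skip)
          ⟨2, le_rfl, .ite_false (by simpa using hne) (.load _ _ _)⟩).mono
          (b' := B + 4) (by omega)
        have h0 : [s].count Computability.Γ'.comma = 0 :=
          List.count_eq_zero.2 (by simpa [eq_comm] using hs)
        rw [h0]
        exact ⟨_, h2⟩
    obtain ⟨r', t, ht, he⟩ := hbody
    obtain ⟨r'', t', ht', he'⟩ := ih (decodeSym C s :: x) (q + [s].count Computability.Γ'.comma) r'
    refine ⟨r'', t' + t + 1, ?_, ?_⟩
    · rw [List.length_cons, Nat.succ_mul]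
      omega
    · have ecount : q + [s].count Computability.Γ'.comma + u.count Computability.Γ'.comma =
          q + (s :: u).count Computability.Γ'.comma := by
        rw [add_assoc, ← List.count_append, List.singleton_append]
      rw [ecount] at he'
      simp only [List.map_cons, List.reverse_cons, List.append_assoc, List.singleton_append]
      refine Exec.loop_step rfl ?_ he'
      rw [update_stk_inp]
      exact he

end InOut

end P5Coloring

/-! ### Polynomial-time colouring -/

namespace P5Coloring

/-- Write a symbol to the output. -/
def writeOut {C J : Type} (s : Bool ⊕ C) : WProg C J := .push .out fun _ => s

theorem Do.writeOut {C J : Type} [DecidableEq J] (s : Bool ⊕ C) (a : Bool) (i o)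
    (W : Work J → List (Sym C)) :
    Do (writeOut s) a (stk i o W) a (stk i (s :: o) W) 1 := by
  intro r
  rw [← update_stk_out i o W (s :: o)]
  exact ⟨r, 1, le_rfl, .push _ _ _ _⟩

/-- Empty all work stacks and reset the state. -/
noncomputable def cleanUp (C J : Type) [Fintype J] : WProg C J :=
  .seq (clearAll Finset.univ.toList) (.load fun _ => (false, none))

theorem Runs.cleanUp {C J : Type} [DecidableEq J] [Fintype J] (v : St C) (i o) {N : ℕ}
    (W : Work J → List (Sym C)) (hW : ∀ w, (W w).length ≤ N) :
    Runs (cleanUp C J) v (stk i o W) (false, none) (stk i o fun _ => [])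
      (Fintype.card (Work J) * (2 * N + 1) + 2) := by
  obtain ⟨r, h⟩ := (Do.clearAll Finset.univ.toList v.1 i o W hW).congr (W' := fun _ => [])
    (by simp) v.2
  have h2 : Runs (.load fun _ => (false, none)) (v.1, r) (stk i o fun _ => []) (false, none)
      (stk i o fun _ : Work J => []) 1 := ⟨1, le_rfl, .load _ _ _⟩
  refine (h.seq h2).mono ?_
  rw [Finset.length_toList, Finset.card_univ]
  omega

theorem extendable_ofGraph {k n : ℕ} (G : SimpleGraph (Fin n)) :
    Extendable (Inst.ofGraph (Fin k) G) ↔ G.Colorable k :=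
  ⟨fun ⟨φ, _, h⟩ => ⟨SimpleGraph.Coloring.mk φ fun {u v} huv => h u v huv⟩,
    fun ⟨φ⟩ => ⟨φ, fun _ => .inl rfl, fun _ _ huv => φ.valid huv⟩⟩

/-- The colouring program: test with `p` whether the graph is colourable, and if it is, colour the
vertices one after another with the help of the test `q`, and write the answer. -/
noncomputable def colorProg (k : ℕ) {B : ℕ} (hB : 1 ≤ B) (p q : WProg (Fin k) (Option (Fin B))) :
    WProg (Fin k) (Option (Fin B)) :=
  .seq (loadInput (Fin k) B) (.seq (move .aux .mat) (.seq p (.seq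
    (.ite Prod.fst
      (.seq (colorAll ⟨0, hB⟩ q) (.seq emitColors (writeOut (Sum.inl true))))
      (writeOut (Sum.inl false)))
    (cleanUp _ _))))

/-- The time bound is the sum of the times for cleaning up, for finding and writing the colouring,
for the test, for turning over the matrix and for reading the input. -/
theorem exists_runs_colorProg {k B : ℕ} (hB : 1 ≤ B) {p q : WProg (Fin k) (Option (Fin B))}
    {P : (I : Inst (Fin k)) → (Fin 0 → Fin I.n) → Prop} {b : ℕ → ℕ}
    (hp : Decides p (Nat.zero_le B) P b)
    (hP : ∀ I e, P5Free I.graph → (P I e ↔ Extendable I))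
    {Q : (I : Inst (Fin k)) → (Fin 1 → Fin I.n) → Prop} {c : ℕ → ℕ} (hq : Decides q hB Q c)
    (hQ : ∀ I e, P5Free I.graph → (Q I e ↔ Extendable I)) (G : P5FreeGraph) :
    ∃ ans : Option (G.graph.Coloring (Fin k)), (ans.isSome ↔ G.graph.Colorable k) ∧
      Runs (colorProg k hB p q) (false, none) (stk G.encode [] fun _ => []) (false, none)
        (stk [] (encodeAnswer ans) fun _ => [])
        (Fintype.card (Work (Option (Fin B))) * (2 * (G.n * (G.n + 1) + 2 * G.n) + 1) + 2 +
          (G.n * (k * (c G.n + 8 * (G.n + 1) ^ 2 + 2) + 4) + 5 * (G.n * (G.n + 1)) + 5) + b G.n +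
          (2 * (G.n * (G.n + 1)) + 1) + (G.n * (G.n + 1) * (B + 5) + 1)) := by
  classical
  let W₀ : Work (Option (Fin B)) → List (Sym (Fin k)) :=
    cmem (Inst.ofGraph (Fin k) G.graph) (loCount G.n) (hiCount G.n)
  have hload : Do (loadInput (Fin k) B) false (stk G.encode [] fun _ => []) false
      (stk [] [] (mem [] (Inst.ofGraph (Fin k) G.graph).matrix.reverse
        (fun j => rep (loCount G.n j)) (fun j => rep (hiCount G.n j)) fun _ => []))
      (G.n * (G.n + 1) * (B + 5) + 1) := by
    have h := Do.loadInput (C := Fin k) (B := B) false G.encode [] [] 0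
    have e : (mem [] [] (fun j => rep (loCount 0 j)) (fun j => rep (hiCount 0 j)) fun _ => [] :
        Work (Option (Fin B)) → List (Sym (Fin k))) = fun _ => [] := by
      funext w
      rcases w with _ | _ | (_ | t) | (_ | t) | t <;> rfl
    rwa [e, map_decodeSym_encode, List.append_nil, count_comma_encode, zero_add,
      length_encode] at h
  have hmove : Do (move .aux .mat) false (stk [] [] (mem []
      (Inst.ofGraph (Fin k) G.graph).matrix.reverse (fun j : Option (Fin B) => rep (loCount G.n j))
      (fun j => rep (hiCount G.n j)) fun _ => [])) false (stk [] [] W₀)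
      (2 * (G.n * (G.n + 1)) + 1) := by
    have h := Do.move (a := false) (i := []) (o := []) (w := .aux) (w' := .mat)
      (n := G.n * (G.n + 1)) (W := mem [] (Inst.ofGraph (Fin k) G.graph).matrix.reverse
        (fun j : Option (Fin B) => rep (loCount G.n j)) (fun j => rep (hiCount G.n j)) fun _ => [])
      (by simp) (by
        simp only [mem, List.length_reverse, Inst.length_matrix]
        exact le_rfl)
    rw [update_mem_mat, update_mem_aux] at h
    simp only [mem, List.reverse_reverse, List.append_nil] at h
    exact h
  have htest := hp (Inst.ofGraph (Fin k) G.graph) Fin.elim0 (loCount G.n) (hiCount G.n) rfl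
    (fun t => t.elim0) (fun t _ => ⟨rfl, rfl⟩) false [] []
  -- what is left to do after the test: to write the answer with a program `p'`, whatever contents
  -- it leaves on the work stacks
  have hfinish : ∀ {a₁ : Bool} {out : List (Bool ⊕ Fin k)} {x h : Option (Fin B) → ℕ}
      {m : List (Sym (Fin k))} {b' : ℕ} {p'}, m.length ≤ G.n * (G.n + 1) →
      (∀ j, x j ≤ loCount G.n j + G.n) → (∀ j, h j ≤ hiCount G.n j) →
      Do p' (decide (P (Inst.ofGraph (Fin k) G.graph) Fin.elim0)) (stk [] [] W₀) a₁
        (stk [] out (mem m [] (fun j => rep (x j)) (fun j => rep (h j)) fun _ => [])) b' →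
      Runs (.seq (loadInput (Fin k) B) (.seq (move .aux .mat) (.seq p (.seq p' (cleanUp _ _)))))
        (false, none) (stk G.encode [] fun _ => []) (false, none) (stk [] out fun _ => [])
        (Fintype.card (Work (Option (Fin B))) * (2 * (G.n * (G.n + 1) + 2 * G.n) + 1) + 2 + b' +
          b G.n + (2 * (G.n * (G.n + 1)) + 1) + (G.n * (G.n + 1) * (B + 5) + 1)) := by
    intro a₁ out x h m b' p' hm hx hh hdo
    obtain ⟨r₁, h1⟩ := hload none
    obtain ⟨r₂, h2⟩ := hmove r₁
    obtain ⟨r₃, h3⟩ := htest r₂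
    obtain ⟨r₄, h4⟩ := hdo r₃
    have h5 := Runs.cleanUp (a₁, r₄) [] out (N := G.n * (G.n + 1) + 2 * G.n)
      (mem m [] (fun j => rep (x j)) (fun j => rep (h j)) fun _ => []) fun w => by
        have hlo : ∀ j : Option (Fin B), loCount G.n j ≤ G.n := by
          rintro (_ | _) <;> simp [loCount]
        have hhi : ∀ j : Option (Fin B), hiCount G.n j ≤ G.n := by
          rintro (_ | _) <;> simp [hiCount]
        rcases w with _ | _ | j | j | j
        · simp only [mem]
          omega
        · simp [mem]
        · have := hx j
          have := hlo j
          simp only [mem, List.length_replicate]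
          omega
        · have := hh j
          have := hhi j
          simp only [mem, List.length_replicate]
          omega
        · simp [mem]
    exact h1.seq (h2.seq (h3.seq (h4.seq h5)))
  by_cases hcol : G.graph.Colorable k
  · have hext := (extendable_ofGraph G.graph).2 hcol
    obtain ⟨φ, x, h, hx, hh, hdo⟩ := hq.colorAll hQ G.p5free hext (x := loCount G.n)
      (h := hiCount G.n) rfl (fun t => ⟨rfl, rfl⟩) [] []
    refine ⟨some φ, by simp [hcol], ?_⟩
    have hemit := Do.emitColors true [] [] (Inst.matrix ⟨G.n, G.graph, fun v => some (φ v)⟩)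
      (fun j => rep (x j)) (fun j => rep (h j)) fun _ => []
    rw [filterMap_encodeSym_matrix, List.append_nil, Inst.length_matrix] at hemit
    refine hfinish (a₁ := true) (m := []) (Nat.zero_le _) hx hh ?_
    rw [decide_eq_true ((hP (Inst.ofGraph (Fin k) G.graph) Fin.elim0 G.p5free).2 hext)]
    have hw := Do.writeOut (Sum.inl true) true [] ((List.finRange G.n).map fun v => Sum.inr (φ v))
      (mem [] [] (fun j => rep (x j)) (fun j => rep (h j)) fun _ => [])
    refine (hdo.seq (hemit.seq hw)).ite_true.mono ?_
    rw [Fintype.card_fin]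
    dsimp only
    omega
  · have hext := fun h => hcol ((extendable_ofGraph G.graph).1 h)
    refine ⟨none, by simp [hcol], ?_⟩
    refine hfinish (a₁ := false) (m := (Inst.ofGraph (Fin k) G.graph).matrix) (x := loCount G.n)
      (h := hiCount G.n) (Inst.length_matrix _).le (fun j => Nat.le_add_right _ _)
      (fun j => le_rfl) ?_
    rw [decide_eq_false fun h => hext ((hP (Inst.ofGraph (Fin k) G.graph) Fin.elim0 G.p5free).1 h)]
    exact (Do.writeOut (Sum.inl false) false [] [] W₀).ite_false.mono (by omega)

theorem eval_mono_nat (T : Polynomial ℕ) {x y : ℕ} (h : x ≤ y) : T.eval x ≤ T.eval y := by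
  rw [Polynomial.eval_eq_sum_range, Polynomial.eval_eq_sum_range]
  exact Finset.sum_le_sum fun i _ => Nat.mul_le_mul_left _ (Nat.pow_le_pow_left h i)

/-- There are a program and a polynomial time bound, in terms of the number of vertices, for the
colouring problem. -/
theorem exists_colorProg (k : ℕ) :
    ∃ (B : ℕ) (p : WProg (Fin k) (Option (Fin B))) (T : Polynomial ℕ), ∀ G : P5FreeGraph,
      ∃ ans : Option (G.graph.Coloring (Fin k)), (ans.isSome ↔ G.graph.Colorable k) ∧
        Runs p (false, none) (stk G.encode [] fun _ => []) (false, none)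
          (stk [] (encodeAnswer ans) fun _ => []) (T.eval G.n) := by
  obtain ⟨P, hPfo, hP⟩ := exists_fo_extendable (Fin k) 0
  obtain ⟨Q, hQfo, hQ⟩ := exists_fo_extendable (Fin k) 1
  obtain ⟨d₀, h₀⟩ := hPfo.exists_decides
  obtain ⟨d₁, h₁⟩ := hQfo.exists_decides
  obtain ⟨p, b, hp⟩ := h₀ (1 + d₀ + d₁) (Nat.zero_le _) (by omega)
  obtain ⟨q, c, hq⟩ := h₁ (1 + d₀ + d₁) (by omega) (by omega)
  let N : Polynomial ℕ := Polynomial.X * (Polynomial.X + 1)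
  refine ⟨1 + d₀ + d₁, colorProg k (by omega) p q,
    (Fintype.card (Work (Option (Fin (1 + d₀ + d₁)))) : Polynomial ℕ) *
      (2 * (N + 2 * Polynomial.X) + 1) + 2 + (Polynomial.X * ((k : Polynomial ℕ) *
      (c + 8 * (Polynomial.X + 1) ^ 2 + 2) + 4) + 5 * N + 5) + b + (2 * N + 1) +
      (N * (((1 + d₀ + d₁ : ℕ) : Polynomial ℕ) + 5) + 1), fun G => ?_⟩
  obtain ⟨ans, h1, h2⟩ := exists_runs_colorProg (by omega) hp hP hq hQ G
  refine ⟨ans, h1, h2.mono (le_of_eq ?_)⟩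
  simp only [N, Polynomial.eval_add, Polynomial.eval_mul, Polynomial.eval_X, Polynomial.eval_one,
    Polynomial.eval_pow, Polynomial.eval_ofNat, Polynomial.eval_natCast, Nat.cast_id]

end P5Coloring

/-- For each fixed `k` there is an algorithm `colour`, carried out by a multi-stack Turing machine
in a number of steps polynomial in the length of the input word, that on every `P₅`-free graph
returns a proper `k`-colouring if there is one, and "no" otherwise. -/
theorem mainTheorem2 (k : ℕ) :
    ∃ colour : (G : P5FreeGraph) → Option (G.graph.Coloring (Fin k)),
      (∀ G : P5FreeGraph, (colour G).isSome ↔ G.graph.Colorable k) ∧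
      Nonempty (Turing.TM2ComputableInPolyTime P5FreeGraph.encode
        (id : List (Bool ⊕ Fin k) → List (Bool ⊕ Fin k))
        (fun G => encodeAnswer (colour G))) := by
  obtain ⟨B, p, T, h⟩ := P5Coloring.exists_colorProg k
  choose colour hcol hruns using h
  refine ⟨colour, hcol, ?_⟩
  -- the additional step is the halting of the machine
  have hout : ∀ G : P5FreeGraph, Nonempty (Turing.TM2OutputsInTime
      (p.machine P5Coloring.Stk.inp P5Coloring.Stk.out (false, none)) G.encode
      (some (encodeAnswer (colour G)))
      ((T + 1).eval G.encode.length)) := by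
    intro G
    obtain ⟨t, ht, he⟩ := hruns G
    refine he.outputsInTime ?_ ?_ ?_
    · have := P5Coloring.eval_mono_nat T (show G.n ≤ G.encode.length by
        rw [P5Coloring.length_encode]; nlinarith)
      simp only [Polynomial.eval_add, Polynomial.eval_one]
      omega
    · funext s
      rcases s with _ | _ | w <;> rfl
    · funext s
      rcases s with _ | _ | w <;> rfl
  exact ⟨{
    tm := p.machine P5Coloring.Stk.inp P5Coloring.Stk.out (false, none)
    inputAlphabet := Equiv.refl _
    outputAlphabet := Equiv.refl _
    time := T + 1
    outputsFun := fun G => by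
      have e {α : Type} (l : List α) : l.map (Equiv.refl α).invFun = l := List.map_id l
      exact cast (congrArg₂ (fun a b => Turing.TM2OutputsInTime
        (p.machine P5Coloring.Stk.inp P5Coloring.Stk.out (false, none)) a (some b)
        ((T + 1).eval G.encode.length))
        (e G.encode).symm (e (encodeAnswer (colour G))).symm) (Classical.choice (hout G)) }⟩
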